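/- Let $\mathbb T=\mathbb R/2\pi\mathbb Z$, let $d,\kappa,f\in\mathbb R$ with $d\neq 0$, $\kappa>0$, $f\neq 0$, and consider pairs $(a,\zeta)\in H^2(\mathbb T;\mathbb C)\times\mathbb R$ that solve the stationary Lugiato–Lefever equation with two-photon absorption $$-d a''-(\mathrm i-\zeta)a-(1+\mathrm i\kappa)|a|^2a+\mathrm i f=0\quad\text{on }\mathbb T. \tag{1}$$ A constant solution $(a_0,\zeta)$, $a_0\in\mathbb C$, is called a bifurcation point if every neighbourhood of it in $H^2(\mathbb T;\mathbb C)\times\mathbb R$ contains a solution $(a,\tilde\zeta)$ of (1) with $a$ nonconstant. Let $\mathbb N=\{1,2,3,\dots\}$. Then the following holds. (i) The set of all constant solutions of (1) is a smooth unbounded curve in $H^2(\mathbb T;\mathbb C)\times\mathbb R$: it is the image of a $C^\infty$ map $\gamma:\mathbb R\to H^2(\mathbb T;\mathbb C)\times\mathbb R$ that is a homeomorphism onto its image and satisfies $\gamma'(t)\ne 0$ for all $t$; moreover, it is unbounded in the $\zeta$-component. (ii) Let $(a_0,\zeta)$ be a constant solution with $D:=(1-3\kappa^2)|a_0|^4-4\kappa|a_0|^2-1\ge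 0$ and put $$k_{1,2}:=\sqrt{\frac{2|a_0|^2-\zeta\pm\sqrt{D}}{d}}$$ (a number $k_j$ that is not real is not in $\mathbb N$). If exactly one of the two numbers $k_1,k_2$ is in $\mathbb N$ (they count as one number if they coincide) and $$2(3\kappa^2-1)|a_0|^4\bigl(|a_0|^2-\zeta\bigr)+4\kappa|a_0|^2\bigl(|a_0|^2-\zeta\bigr)\pm\sqrt{D}\,\Bigl(1+\zeta^2-(1-3\kappa^2)|a_0|^4+4\kappa|a_0|^2\Bigr)\neq 0$$ with "$+$" if $k_1\in\mathbb N$ and "$-$" if $k_2\in\mathbb N$, then $(a_0,\zeta)$ is a bifurcation point. (iii) If $\kappa>\kappa_*$, then no constant solution of (1) is a bifurcation point. Here $\kappa_*:=0$ if $f^2\le 1$, and if $f^2>1$ then $$\kappa_*:=\max\Bigl\{k\in\bigl(0,\tfrac1{\sqrt3}\bigr):\ \frac{2k+\sqrt{1+k^2}}{(1-3k^2)^3}\bigl(1-k^2+k\sqrt{1+k^2}\bigr)^2\le f^2\Bigr\};$$ this maximum exists, and it is the unique $k\in(0,\tfrac1{\sqrt3})$ for which equality holds. -/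

import Mathlib

open Real MeasureTheory Set
open scoped ENNReal ContDiff

noncomputable section

namespace LugiatoLefever

/-! ### The torus and the Sobolev space `H²(𝕋)` of complex-valued functions -/

/-- `2π > 0`, needed for the normalised Haar measure on `ℝ / 2πℤ`. -/
instance twoPiPos : Fact ((0 : ℝ) < 2 * π) := ⟨Real.two_pi_pos⟩

/-- The one-dimensional torus `𝕋 = ℝ / 2πℤ`. -/
abbrev Torus : Type := AddCircle (2 * π)

/-- Lebesgue measure on the torus, normalised to total mass one. -/
abbrev torusMeasure : Measure Torus := AddCircle.haarAddCircle

/-- `L²(𝕋; ℂ)`. -/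
abbrev L2 : Type := Lp ℂ 2 torusMeasure

/-- `v` is the weak derivative of `u` on the torus: `∫ u φ' = - ∫ v φ` for every smooth test
function `φ` on `𝕋` (that is, every `φ` whose `2π`-periodic lift to `ℝ` is smooth); `ψ` is the
derivative of `φ`. -/
def IsWeakDeriv (u v : L2) : Prop :=
  ∀ φ ψ : Torus → ℂ, ContDiff ℝ ∞ (fun y : ℝ => φ (y : Torus)) →
    (∀ y : ℝ, HasDerivAt (fun y : ℝ => φ (y : Torus)) (ψ (y : Torus)) y) →
    ∫ x, u x * ψ x ∂torusMeasure = - ∫ x, v x * φ x ∂torusMeasure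

theorem continuous_of_lift {φ : Torus → ℂ} (h : Continuous fun y : ℝ => φ (y : Torus)) :
    Continuous φ :=
  (QuotientAddGroup.isQuotientMap_mk (N := AddSubgroup.zmultiples (2 * π))).continuous_iff.2 h

theorem continuous_test {φ ψ : Torus → ℂ} (h : ContDiff ℝ ∞ (fun y : ℝ => φ (y : Torus)))
    (h' : ∀ y : ℝ, HasDerivAt (fun y : ℝ => φ (y : Torus)) (ψ (y : Torus)) y) :
    Continuous φ ∧ Continuous ψ := by
  refine ⟨continuous_of_lift h.continuous, continuous_of_lift ?_⟩
  have e : (fun y : ℝ => ψ (y : Torus)) = deriv (fun y : ℝ => φ (y : Torus)) := by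
    funext y; exact (h' y).deriv.symm
  rw [e]
  exact h.continuous_deriv (by simp)

theorem integrable_mul_test (u : L2) {φ : Torus → ℂ} (hφ : Continuous φ) :
    Integrable (fun x => u x * φ x) torusMeasure := by
  have hu : Integrable u torusMeasure := (Lp.memLp u).integrable (by norm_num)
  obtain ⟨C, hC⟩ := isCompact_univ.exists_bound_of_continuousOn hφ.continuousOn
  exact hu.mul_bdd (c := C) hφ.aestronglyMeasurable (Filter.Eventually.of_forall fun x => hC x trivial)

theorem IsWeakDeriv.add {u v u' v' : L2} (h : IsWeakDeriv u v) (h' : IsWeakDeriv u' v') :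
    IsWeakDeriv (u + u') (v + v') := by
  intro φ ψ hφ hψ
  obtain ⟨c1, c2⟩ := continuous_test hφ hψ
  have e1 : ∫ x, (u + u' : L2) x * ψ x ∂torusMeasure
      = ∫ x, (u x * ψ x + u' x * ψ x) ∂torusMeasure := by
    apply integral_congr_ae
    filter_upwards [Lp.coeFn_add u u'] with x hx
    rw [hx, Pi.add_apply, add_mul]
  have e2 : ∫ x, (v + v' : L2) x * φ x ∂torusMeasure
      = ∫ x, (v x * φ x + v' x * φ x) ∂torusMeasure := by
    apply integral_congr_ae
    filter_upwards [Lp.coeFn_add v v'] with x hx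
    rw [hx, Pi.add_apply, add_mul]
  rw [e1, e2, integral_add (integrable_mul_test u c2) (integrable_mul_test u' c2),
    integral_add (integrable_mul_test v c1) (integrable_mul_test v' c1), h φ ψ hφ hψ,
    h' φ ψ hφ hψ]
  ring

theorem IsWeakDeriv.smul (c : ℝ) {u v : L2} (h : IsWeakDeriv u v) :
    IsWeakDeriv (c • u) (c • v) := by
  intro φ ψ hφ hψ
  have e1 : ∫ x, (c • u : L2) x * ψ x ∂torusMeasure
      = ∫ x, c • (u x * ψ x) ∂torusMeasure := by
    apply integral_congr_ae
    filter_upwards [Lp.coeFn_smul c u] with x hx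
    rw [hx, Pi.smul_apply, smul_mul_assoc]
  have e2 : ∫ x, (c • v : L2) x * φ x ∂torusMeasure
      = ∫ x, c • (v x * φ x) ∂torusMeasure := by
    apply integral_congr_ae
    filter_upwards [Lp.coeFn_smul c v] with x hx
    rw [hx, Pi.smul_apply, smul_mul_assoc]
  rw [e1, e2, integral_smul, integral_smul, h φ ψ hφ hψ, smul_neg]

theorem IsWeakDeriv.zero : IsWeakDeriv 0 0 := by
  intro φ ψ _ _
  have e : ∀ χ : Torus → ℂ, ∫ x, (0 : L2) x * χ x ∂torusMeasure = 0 := by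
    intro χ
    rw [integral_eq_zero_of_ae]
    filter_upwards [Lp.coeFn_zero ℂ 2 torusMeasure] with x hx
    rw [hx]; simp
  rw [e, e, neg_zero]

/-- `H²(𝕋; ℂ)` as a real normed space: the triples `(a, a', a'')` in `L²(𝕋; ℂ)³` such that `a'` is
the weak derivative of `a` and `a''` is the weak derivative of `a'`. The norm, inherited from the
`ℓ²`-product, is the Sobolev norm `(‖a‖² + ‖a'‖² + ‖a''‖²)^(1/2)`. -/
def H2 : Submodule ℝ (PiLp 2 (fun _ : Fin 3 => L2)) where
  carrier := {p | IsWeakDeriv (p 0) (p 1) ∧ IsWeakDeriv (p 1) (p 2)}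
  add_mem' := by
    rintro p q ⟨h1, h2⟩ ⟨h3, h4⟩
    exact ⟨h1.add h3, h2.add h4⟩
  zero_mem' := ⟨IsWeakDeriv.zero, IsWeakDeriv.zero⟩
  smul_mem' := by
    rintro c p ⟨h1, h2⟩
    exact ⟨h1.smul c, h2.smul c⟩

/-- The `L²`-function underlying `a ∈ H²(𝕋)`. -/
def H2.fn (a : H2) : L2 := (a : PiLp 2 (fun _ : Fin 3 => L2)) 0

/-- The second weak derivative of `a ∈ H²(𝕋)`. -/
def H2.deriv2 (a : H2) : L2 := (a : PiLp 2 (fun _ : Fin 3 => L2)) 2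

theorem isWeakDeriv_const (c : ℂ) : IsWeakDeriv (Lp.const 2 torusMeasure c) 0 := by
  intro φ ψ hφ hψ
  obtain ⟨_, c2⟩ := continuous_test hφ hψ
  have e1 : ∫ x, (Lp.const 2 torusMeasure c : L2) x * ψ x ∂torusMeasure
      = ∫ x, c * ψ x ∂torusMeasure := by
    apply integral_congr_ae
    filter_upwards [Lp.coeFn_const (p := 2) (μ := torusMeasure) c] with x hx
    rw [hx, Function.const_apply]
  have e2 : ∫ x, (0 : L2) x * φ x ∂torusMeasure = 0 := by
    rw [integral_eq_zero_of_ae]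
    filter_upwards [Lp.coeFn_zero ℂ 2 torusMeasure] with x hx
    rw [hx]; simp
  have e3 : ∫ x : Torus, ψ x = 0 := by
    rw [← AddCircle.intervalIntegral_preimage (2 * π) 0 ψ,
      intervalIntegral.integral_eq_sub_of_hasDerivAt (fun y _ => hψ y)
        ((c2.comp (AddCircle.continuous_mk' _)).intervalIntegrable _ _)]
    simp only [zero_add, AddCircle.coe_period, AddCircle.coe_zero, sub_self]
  rw [e1, e2, integral_const_mul, AddCircle.integral_haarAddCircle, e3]
  simp

/-- The constant function `c` as an element of `H²(𝕋)`. -/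
def H2.const (c : ℂ) : H2 :=
  ⟨WithLp.toLp 2 ![Lp.const 2 torusMeasure c, 0, 0], isWeakDeriv_const c, IsWeakDeriv.zero⟩

/-! ### The stationary equation, constant solutions and bifurcation points -/

/-- `a ∈ H²(𝕋)` solves `-d a'' - (i - ζ) a - (1 + iκ) |a|² a + i f = 0` (almost everywhere). -/
def IsSolution (d κ f ζ : ℝ) (a : H2) : Prop :=
  ∀ᵐ x ∂torusMeasure,
    -(d : ℂ) * H2.deriv2 a x - (Complex.I - ζ) * H2.fn a x
      - (1 + Complex.I * κ) * ((‖H2.fn a x‖ ^ 2 : ℝ) : ℂ) * H2.fn a x + Complex.I * f = 0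

/-- The set of all solutions `(a, ζ)` in `H²(𝕋) × ℝ`. -/
def solutions (d κ f : ℝ) : Set (H2 × ℝ) := {p | IsSolution d κ f p.2 p.1}

/-- The set of all constant (trivial) solutions `(a, ζ)` in `H²(𝕋) × ℝ`. -/
def constSolutions (d κ f : ℝ) : Set (H2 × ℝ) :=
  {p | p ∈ solutions d κ f ∧ ∃ c : ℂ, p.1 = H2.const c}

/-- A constant solution is a bifurcation point if each of its neighbourhoods in `H²(𝕋) × ℝ`
contains a nonconstant solution. -/
def IsBifurcationPoint (d κ f : ℝ) (p : H2 × ℝ) : Prop :=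
  p ∈ constSolutions d κ f ∧ p ∈ closure (solutions d κ f \ constSolutions d κ f)

/-! ### The explicit quantities -/

/-- `(1 - 3κ²)|a₀|⁴ - 4κ|a₀|² - 1`. -/
def disc (κ : ℝ) (a₀ : ℂ) : ℝ := (1 - 3 * κ ^ 2) * ‖a₀‖ ^ 4 - 4 * κ * ‖a₀‖ ^ 2 - 1

/-- The number `k₁` (for `σ = 1`) or `k₂` (for `σ = -1`). It is meaningful only if `disc κ a₀ ≥ 0`;
if the quotient under the outer root is negative then the value is `0`. -/
def kNumber (d κ ζ : ℝ) (a₀ : ℂ) (σ : ℝ) : ℝ :=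
  √((2 * ‖a₀‖ ^ 2 - ζ + σ * √(disc κ a₀)) / d)

/-- The real number `x` is a positive integer. -/
def IsPosNat (x : ℝ) : Prop := ∃ k : ℕ, 1 ≤ k ∧ x = k

/-- The transversality expression, with sign `σ = ±1` in front of the root. -/
def transversality (κ ζ : ℝ) (a₀ : ℂ) (σ : ℝ) : ℝ :=
  2 * (3 * κ ^ 2 - 1) * ‖a₀‖ ^ 4 * (‖a₀‖ ^ 2 - ζ) + 4 * κ * ‖a₀‖ ^ 2 * (‖a₀‖ ^ 2 - ζ)
    + σ * √(disc κ a₀) *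
      (1 + ζ ^ 2 - (1 - 3 * κ ^ 2) * ‖a₀‖ ^ 4 + 4 * κ * ‖a₀‖ ^ 2)

/-- The function of `κ` that determines the threshold. -/
def thresholdFun (κ : ℝ) : ℝ :=
  (2 * κ + √(1 + κ ^ 2)) / (1 - 3 * κ ^ 2) ^ 3 * (1 - κ ^ 2 + κ * √(1 + κ ^ 2)) ^ 2

/-- The set whose maximum is `κ_*` if `f² > 1`. -/
def thresholdSet (f : ℝ) : Set ℝ := {κ | κ ∈ Ioo 0 (1 / √3) ∧ thresholdFun κ ≤ f ^ 2}

/-- The threshold `κ_*`. -/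
def kappaStar (f : ℝ) : ℝ := if 1 < f ^ 2 then sSup (thresholdSet f) else 0

end LugiatoLefever

end

noncomputable section

namespace LugiatoLefever

open ComplexConjugate

/-! Weak derivatives are translated into Fourier coefficients (`isWeakDeriv_iff`). Then a function
in H² is its mean minus `invLap` of its second derivative, and `invLap` maps L² boundedly into C(𝕋).
The cubic term is therefore a polynomial in the Banach algebra C(𝕋).

(i) Write A = |c|² for a constant solution c and t = (ζ - A)/(1 + κA). The equation gives A(1 +
κA)²(1 + t²) = f². Since x + κx³ has a smooth inverse, t determines A, and hence c and ζ.
Conversely, t is a smooth function of (c, ζ), so the parametrisation has a smooth left inverse. This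
makes it an embedding with nonzero derivative.

(iii) Write a = m + w with m the mean. Multiply the equation by the conjugate of w, integrate and
take imaginary parts: the a'' term is real and the constant terms integrate to zero. What remains is
at least (1 + 2κ|m|² - √(1+κ²)|m|²)‖w‖² minus terms that are small if w is uniformly small. The
coefficient is positive exactly when `disc` is negative, so near such a constant solution every
solution is constant (`eq_const_of_coercivity_pos`). If instead `disc` is nonnegative then A is at
least `discRoot`, so f² ≥ A(1 + κA)² ≥ `thresholdFun κ`, and monotonicity of `thresholdFun` bounds κ
by `kappaStar`.

(ii) Restricting to even functions removes the translation degeneracy, so the modes ±n become one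
real-linear map z ↦ αz + βz̄ on ℂ. Seek solutions c + s v with v mean-free, and divide the mean-free
part of the equation by s. At s = 0 the rescaled equation says that c is a constant solution and v a
kernel element of the linearisation there. Its derivative in ζ and g, where g encodes c as its mean
and v = `invLap g`, is onto: mode 0 by `dConstEq_surjective`, mode k because its determinant has
nonzero derivative along the curve of constant solutions (`exists_tangent`, `exists_decomposition`),
and all other modes because their determinants do not vanish, with uniform bounds
(`exists_bound_modes`). A map with surjective strict derivative is locally onto, so zeros with small
s ≠ 0 exist near the starting point, and they give nonconstant solutions. No Lyapunov–Schmidt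
reduction and no normalisation of v is needed. -/

/-! ### Fourier coefficients -/

/-- The `n`-th Fourier coefficient as a functional on `L²(𝕋)`. -/
def coeff (n : ℤ) : L2 →L[ℂ] ℂ := innerSL ℂ (fourierLp (T := 2 * π) 2 n)

theorem coeff_eq_repr (n : ℤ) (u : L2) : coeff n u = (fourierBasis (T := 2 * π)).repr u n := by
  rw [HilbertBasis.repr_apply_apply, coe_fourierBasis]; rfl

theorem coeff_eq_fourierCoeff (n : ℤ) (u : L2) : coeff n u = fourierCoeff u n := by
  rw [coeff_eq_repr, fourierBasis_repr]

theorem norm_coeff_le (n : ℤ) (u : L2) : ‖coeff n u‖ ≤ ‖u‖ := by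
  have h := (orthonormal_fourier (T := 2 * π)).1 n
  calc ‖coeff n u‖ ≤ ‖fourierLp (T := 2 * π) 2 n‖ * ‖u‖ :=
        norm_inner_le_norm (𝕜 := ℂ) (fourierLp (T := 2 * π) 2 n) u
    _ = ‖u‖ := by rw [h, one_mul]

theorem coeff_smul_real (n : ℤ) (r : ℝ) (u : L2) : coeff n (r • u) = r * coeff n u := by
  rw [map_real_smul (coeff n) (coeff n).continuous, Complex.real_smul]

theorem ext_coeff {u v : L2} (h : ∀ n, coeff n u = coeff n v) : u = v := by
  apply (fourierBasis (T := 2 * π)).repr.injective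
  ext n
  rw [← coeff_eq_repr, ← coeff_eq_repr, h]

theorem hasSum_sq_coeff (u : L2) : HasSum (fun n => ‖coeff n u‖ ^ 2) (‖u‖ ^ 2) := by
  have h := lp.hasSum_norm (p := 2) (by simp) ((fourierBasis (T := 2 * π)).repr u)
  simp only [LinearIsometryEquiv.norm_map] at h
  simp_rw [coeff_eq_repr]
  exact_mod_cast h

theorem hasSum_coeff_mul (u v : L2) :
    HasSum (fun n => conj (coeff n u) * coeff n v) (inner ℂ u v) := by
  have h := (fourierBasis (T := 2 * π)).hasSum_inner_mul_inner u v
  refine (funext fun n => ?_ : (fun n => conj (coeff n u) * coeff n v) = _) ▸ h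
  rw [← HilbertBasis.repr_apply_apply, ← coeff_eq_repr, ← inner_conj_symm u,
    ← HilbertBasis.repr_apply_apply, ← coeff_eq_repr]

theorem exists_coeff_eq (u : L2) (b : ℤ → ℂ) (C : ℝ) (h : ∀ n, ‖b n‖ ≤ C * ‖coeff n u‖) :
    ∃ w : L2, (∀ n, coeff n w = b n) ∧ ‖w‖ ≤ |C| * ‖u‖ := by
  have hs : Summable fun n => ‖b n‖ ^ 2 := by
    refine Summable.of_nonneg_of_le (fun n => by positivity) (fun n => ?_)
      ((hasSum_sq_coeff u).summable.mul_left (C ^ 2))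
    rw [← mul_pow]
    gcongr
    exact h n
  have hb : Memℓp b 2 := memℓp_gen (by simpa using hs)
  have hw : ∀ n, coeff n ((fourierBasis (T := 2 * π)).repr.symm ⟨b, hb⟩) = b n := by
    intro n
    rw [coeff_eq_repr, LinearIsometryEquiv.apply_symm_apply]
  refine ⟨_, hw, ?_⟩
  refine abs_le_of_sq_le_sq' ?_ (by positivity) |>.2
  have h1 := hasSum_sq_coeff ((fourierBasis (T := 2 * π)).repr.symm ⟨b, hb⟩)
  have h2 := (hasSum_sq_coeff u).mul_left (C ^ 2)
  rw [mul_pow, sq_abs]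
  refine hasSum_le (fun n => ?_) h1 h2
  rw [hw, ← mul_pow]
  gcongr
  exact h n

/-- A bounded symbol `m` defines a Fourier multiplier on `L²(𝕋)`. -/
theorem exists_multiplier (m : ℤ → ℂ) (C : ℝ) (h : ∀ n, ‖m n‖ ≤ C) :
    ∃ T : L2 →L[ℂ] L2, ∀ u n, coeff n (T u) = m n * coeff n u := by
  have key := fun u : L2 => exists_coeff_eq u (fun n => m n * coeff n u) C
    (fun n => by rw [norm_mul]; gcongr; exact h n)
  choose T hT hT' using key
  refine ⟨LinearMap.mkContinuous ⟨⟨T, ?_⟩, ?_⟩ |C| hT', hT⟩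
  · intro u v
    refine ext_coeff fun n => ?_
    simp only [map_add, hT]; ring
  · intro c u
    refine ext_coeff fun n => ?_
    simp only [map_smul, hT, smul_eq_mul, RingHom.id_apply]; ring

/-- Continuous functions as elements of `L²(𝕋)`. -/
abbrev toL2 : C(Torus, ℂ) →L[ℂ] L2 := ContinuousMap.toLp 2 torusMeasure ℂ

theorem coeff_toL2 (n : ℤ) (h : C(Torus, ℂ)) : coeff n (toL2 h) = fourierCoeff h n := by
  rw [coeff_eq_fourierCoeff, fourierCoeff_toLp]

theorem coeff_fourier (n m : ℤ) : coeff n (toL2 (fourier m)) = if n = m then 1 else 0 := by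
  rw [coeff_toL2, fourierCoeff_fourier, Pi.single_apply]

theorem fourierCoeff_neg_of_even {h : Torus → ℂ} (he : ∀ x, h (-x) = h x) (n : ℤ) :
    fourierCoeff h (-n) = fourierCoeff h n := by
  rw [fourierCoeff, fourierCoeff, ← integral_neg_eq_self]
  congr 1
  ext x
  rw [he]
  congr 1
  simp [fourier_apply]

theorem fourierCoeff_conj (h : Torus → ℂ) (n : ℤ) :
    fourierCoeff (fun x => conj (h x)) n = conj (fourierCoeff h (-n)) := by
  rw [fourierCoeff, fourierCoeff, ← integral_conj]
  congr 1
  ext x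
  rw [smul_eq_mul, smul_eq_mul, map_mul, ← fourier_neg, neg_neg]

/-! ### Weak derivatives in terms of Fourier coefficients -/

theorem integral_deriv_eq_zero {φ ψ : Torus → ℂ} (hψ : Continuous ψ)
    (h : ∀ y : ℝ, HasDerivAt (fun y : ℝ => φ (y : Torus)) (ψ (y : Torus)) y) :
    ∫ x, ψ x ∂torusMeasure = 0 := by
  have e3 : ∫ x : Torus, ψ x = 0 := by
    rw [← AddCircle.intervalIntegral_preimage (2 * π) 0 ψ,
      intervalIntegral.integral_eq_sub_of_hasDerivAt (fun y _ => h y)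
        ((hψ.comp (AddCircle.continuous_mk' _)).intervalIntegrable _ _)]
    simp only [zero_add, AddCircle.coe_period, AddCircle.coe_zero, sub_self]
  rw [AddCircle.integral_haarAddCircle, e3, smul_zero]

theorem hasDerivAt_fourier_torus (n : ℤ) (y : ℝ) :
    HasDerivAt (fun y : ℝ => fourier n (y : Torus))
      (Complex.I * n * fourier n (y : Torus)) y := by
  have h := hasDerivAt_fourier (2 * π) n y
  convert h using 2
  have : (π : ℂ) ≠ 0 := by exact_mod_cast Real.pi_ne_zero
  push_cast
  field_simp

theorem contDiff_fourier_torus (n : ℤ) : ContDiff ℝ ∞ (fun y : ℝ => fourier n (y : Torus)) := by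
  simp only [fourier_coe_apply]
  have : ContDiff ℝ ∞ (fun y : ℝ => (y : ℂ)) := Complex.ofRealCLM.contDiff
  fun_prop

theorem fourierCoeff_deriv {φ ψ : Torus → ℂ} (hφ : Continuous φ) (hψ : Continuous ψ)
    (h : ∀ y : ℝ, HasDerivAt (fun y : ℝ => φ (y : Torus)) (ψ (y : Torus)) y) (n : ℤ) :
    fourierCoeff ψ n = Complex.I * n * fourierCoeff φ n := by
  have hi : ∀ χ : Torus → ℂ, Continuous χ →
      Integrable (fun x => fourier (-n) x * χ x) torusMeasure := fun χ hχ =>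
    ((map_continuous (fourier (-n))).mul hχ).integrable_of_hasCompactSupport
      (HasCompactSupport.of_compactSpace _)
  have key := integral_deriv_eq_zero
    (φ := fun x => fourier (-n) x * φ x)
    (ψ := fun x => fourier (-n) x * ψ x - Complex.I * n * (fourier (-n) x * φ x))
    (((map_continuous (fourier (-n))).mul hψ).sub
      (((map_continuous (fourier (-n))).mul hφ).const_mul _)) (fun y => by
      refine ((hasDerivAt_fourier_torus (-n) y).mul (h y)).congr_deriv ?_
      push_cast
      ring)
  rw [integral_sub (hi ψ hψ) ((hi φ hφ).const_mul _), integral_const_mul, sub_eq_zero] at key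
  exact key

/-- The weak derivative is defined with the bilinear pairing, whereas Parseval is sesquilinear.
Applying Parseval to the conjugate of χ accounts for the index -n. -/
theorem hasSum_integral_mul (u : L2) (χ : C(Torus, ℂ)) :
    HasSum (fun n => coeff n u * fourierCoeff χ (-n)) (∫ x, u x * χ x ∂torusMeasure) := by
  have h := hasSum_coeff_mul (toL2 (star χ)) u
  have e : inner ℂ (toL2 (star χ)) u = ∫ x, u x * χ x ∂torusMeasure := by
    rw [MeasureTheory.L2.inner_def]
    apply integral_congr_ae
    filter_upwards [ContinuousMap.coeFn_toLp (p := 2) (𝕜 := ℂ) torusMeasure (star χ)] with x hx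
    rw [hx]
    simp
  rw [e] at h
  convert h using 2 with n
  rw [coeff_toL2, mul_comm]
  congr 1
  have := fourierCoeff_conj χ n
  rw [show ((star χ : C(Torus, ℂ)) : Torus → ℂ) = fun x => conj (χ x) from rfl, this,
    Complex.conj_conj]

/-- One direction tests with exp(-inx). The other expands both pairings by Parseval, where
differentiation of the test function produces the factor -in termwise. -/
theorem isWeakDeriv_iff {u v : L2} :
    IsWeakDeriv u v ↔ ∀ n, coeff n v = Complex.I * n * coeff n u := by
  constructor
  · intro h n
    have h1 := h (fourier (-n)) (fun x => Complex.I * (-n : ℤ) * fourier (-n) x)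
      (contDiff_fourier_torus _) (hasDerivAt_fourier_torus _)
    rw [coeff_eq_fourierCoeff, coeff_eq_fourierCoeff, fourierCoeff, fourierCoeff]
    simp only [smul_eq_mul]
    have e1 : ∀ w : L2, ∫ x, fourier (-n) x * w x ∂torusMeasure
        = ∫ x, w x * fourier (-n) x ∂torusMeasure := fun w => by simp_rw [mul_comm]
    have e2 : ∫ x, u x * (Complex.I * (-n : ℤ) * fourier (-n) x) ∂torusMeasure
        = Complex.I * (-n : ℤ) * ∫ x, u x * fourier (-n) x ∂torusMeasure := by
      rw [← integral_const_mul]; congr 1; ext x; ring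
    rw [e2] at h1
    rw [e1, e1, ← neg_eq_iff_eq_neg.2 h1]
    push_cast
    ring
  · intro h φ ψ hφ hψ
    obtain ⟨c1, c2⟩ := continuous_test hφ hψ
    have h1 := hasSum_integral_mul u ⟨ψ, c2⟩
    have h2 := (hasSum_integral_mul v ⟨φ, c1⟩).neg
    refine h1.unique ?_
    refine (funext fun n => ?_ : (fun n => coeff n u *
      fourierCoeff (⟨ψ, c2⟩ : C(Torus, ℂ)) (-n)) = _) ▸ h2
    rw [show ((⟨ψ, c2⟩ : C(Torus, ℂ)) : Torus → ℂ) = ψ from rfl,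
      show ((⟨φ, c1⟩ : C(Torus, ℂ)) : Torus → ℂ) = φ from rfl, fourierCoeff_deriv c1 c2 hψ, h]
    push_cast
    ring

/-! ### The inverse of `-∂ₓ²` on mean-free functions -/

/-- The inverse of `-∂ₓ²` on mean-free functions, `g ↦ ∑ₙ n⁻² ĝ(n) exp(inx)`, extended by zero to
constants. -/
def invLap : L2 →L[ℂ] C(Torus, ℂ) :=
  ∑' n : ℤ, (1 / (n : ℂ) ^ 2) • (coeff n).smulRight (fourier n : C(Torus, ℂ))

/-- Each rank-one term has operator norm at most 1/n² as a map into C(𝕋), so the series converges in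
operator norm. This is what makes the values continuous functions. The term n = 0 vanishes by the
convention 1/0 = 0. -/
theorem summable_invLap :
    Summable fun n : ℤ => (1 / (n : ℂ) ^ 2) • (coeff n).smulRight (fourier n : C(Torus, ℂ)) := by
  have hs : Summable fun n : ℤ => |1 / (n : ℝ) ^ 2| :=
    (Real.summable_one_div_int_pow (p := 2)).2 (by norm_num) |>.abs
  refine Summable.of_norm_bounded hs fun n => ?_
  rw [norm_smul]
  have h1 : ‖(coeff n).smulRight (fourier n : C(Torus, ℂ))‖ ≤ 1 := by
    refine ContinuousLinearMap.opNorm_le_bound _ zero_le_one fun u => ?_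
    rw [ContinuousLinearMap.smulRight_apply, norm_smul, fourier_norm, mul_one, one_mul]
    exact norm_coeff_le n u
  have h2 : ‖1 / (n : ℂ) ^ 2‖ = |1 / (n : ℝ) ^ 2| := by
    rw [← Real.norm_eq_abs, ← Complex.norm_real]
    push_cast
    rfl
  rw [h2]
  exact mul_le_of_le_one_right (abs_nonneg _) h1

theorem hasSum_invLap (g : L2) :
    HasSum (fun n : ℤ => (coeff n g / (n : ℂ) ^ 2) • (fourier n : C(Torus, ℂ))) (invLap g) := by
  have h := (ContinuousLinearMap.apply ℂ C(Torus, ℂ) g).hasSum summable_invLap.hasSum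
  refine (funext fun n => ?_ : (fun n : ℤ =>
    (coeff n g / (n : ℂ) ^ 2) • (fourier n : C(Torus, ℂ))) = _) ▸ h
  simp only [ContinuousLinearMap.apply_apply, smul_apply,
    ContinuousLinearMap.smulRight_apply, smul_smul]
  congr 1
  ring

theorem coeff_invLap (g : L2) (n : ℤ) : coeff n (toL2 (invLap g)) = coeff n g / (n : ℂ) ^ 2 := by
  have h := ((coeff n).comp toL2).hasSum (hasSum_invLap g)
  refine h.unique ?_
  convert hasSum_ite_eq n (coeff n g / (n : ℂ) ^ 2) using 2 with m
  simp only [ContinuousLinearMap.comp_apply, map_smul, coeff_fourier]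
  by_cases hm : m = n
  · subst hm; simp
  · simp [hm, Ne.symm hm]

theorem invLap_neg {g : L2} (hg : ∀ n, coeff (-n) g = coeff n g) (x : Torus) :
    invLap g (-x) = invLap g x := by
  have h1 := (ContinuousMap.evalCLM ℂ (-x)).hasSum (hasSum_invLap g)
  have h2 := (ContinuousMap.evalCLM ℂ x).hasSum (hasSum_invLap g)
  have h3 := (Equiv.neg ℤ).hasSum_iff.2 h2
  refine h1.unique ((funext fun n => ?_ : (fun n => ContinuousMap.evalCLM ℂ (-x)
    ((coeff n g / (n : ℂ) ^ 2) • (fourier n : C(Torus, ℂ)))) = _) ▸ h3)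
  simp only [Function.comp_apply, Equiv.neg_apply, map_smul, ContinuousMap.evalCLM_apply, hg]
  congr 1
  · push_cast; ring
  · simp [fourier_apply]

/-! ### The structure of `H²(𝕋)` -/

/-- `a ↦ a` as a bounded map `H²(𝕋) → L²(𝕋)`. -/
def fnL : H2 →L[ℝ] L2 := (PiLp.proj 2 (fun _ : Fin 3 => L2) 0).comp H2.subtypeL

/-- `a ↦ a''` as a bounded map `H²(𝕋) → L²(𝕋)`. -/
def deriv2L : H2 →L[ℝ] L2 := (PiLp.proj 2 (fun _ : Fin 3 => L2) 2).comp H2.subtypeL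

theorem fnL_apply (a : H2) : fnL a = H2.fn a := rfl

theorem deriv2L_apply (a : H2) : deriv2L a = H2.deriv2 a := rfl

theorem coeff_deriv2 (a : H2) (n : ℤ) : coeff n (H2.deriv2 a) = -(n : ℂ) ^ 2 * coeff n (H2.fn a) := by
  have h1 := isWeakDeriv_iff.1 a.2.1 n
  have h2 := isWeakDeriv_iff.1 a.2.2 n
  rw [H2.deriv2, H2.fn, h2, h1]
  linear_combination (n : ℂ) ^ 2 * coeff n ((a : PiLp 2 (fun _ : Fin 3 => L2)) 0) * Complex.I_sq

theorem H2_ext {a b : H2} (h : H2.fn a = H2.fn b) : a = b := by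
  have h0 : (a : PiLp 2 (fun _ : Fin 3 => L2)) 0 = (b : PiLp 2 (fun _ : Fin 3 => L2)) 0 := h
  have h1 : (a : PiLp 2 (fun _ : Fin 3 => L2)) 1 = (b : PiLp 2 (fun _ : Fin 3 => L2)) 1 :=
    ext_coeff fun n => by rw [isWeakDeriv_iff.1 a.2.1, isWeakDeriv_iff.1 b.2.1, h0]
  have h2 : (a : PiLp 2 (fun _ : Fin 3 => L2)) 2 = (b : PiLp 2 (fun _ : Fin 3 => L2)) 2 :=
    ext_coeff fun n => by rw [isWeakDeriv_iff.1 a.2.2, isWeakDeriv_iff.1 b.2.2, h1]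
  apply Subtype.ext
  ext i : 1
  fin_cases i
  exacts [h0, h1, h2]

/-- The mean of a function in `H²(𝕋)`. -/
def meanL : H2 →L[ℝ] ℂ := ((coeff 0).restrictScalars ℝ).comp fnL

theorem toL2_const (c : ℂ) : toL2 (ContinuousMap.const Torus c) = Lp.const 2 torusMeasure c := by
  apply Lp.ext
  filter_upwards [ContinuousMap.coeFn_toLp (p := 2) (𝕜 := ℂ) torusMeasure
    (ContinuousMap.const Torus c), Lp.coeFn_const (p := 2) (μ := torusMeasure) c] with x h1 h2
  rw [h1, h2]
  rfl

theorem coeff_toL2_const (n : ℤ) (c : ℂ) :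
    coeff n (toL2 (ContinuousMap.const Torus c)) = if n = 0 then c else 0 := by
  have : ContinuousMap.const Torus c = c • (fourier 0 : C(Torus, ℂ)) := by
    ext x; simp
  rw [this, map_smul, map_smul, coeff_fourier]
  simp

theorem fn_const (c : ℂ) : H2.fn (H2.const c) = toL2 (ContinuousMap.const Torus c) := by
  rw [toL2_const]; rfl

theorem deriv2_const (c : ℂ) : H2.deriv2 (H2.const c) = 0 := rfl

theorem meanL_const (c : ℂ) : meanL (H2.const c) = c := by
  change coeff 0 (H2.fn (H2.const c)) = c
  rw [fn_const, coeff_toL2_const, if_pos rfl]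

theorem const_injective : Function.Injective H2.const := fun a b h => by
  rw [← meanL_const a, h, meanL_const]

/-- The embedding of the constants into `H²(𝕋)`. -/
def constL : ℂ →L[ℝ] H2 := LinearMap.toContinuousLinearMap
  { toFun := H2.const
    map_add' := fun a b => H2_ext (ext_coeff fun n => by
      rw [← fnL_apply (_ + _), map_add, fnL_apply, fnL_apply, map_add]
      simp only [fn_const, coeff_toL2_const]
      split_ifs <;> simp)
    map_smul' := fun r a => H2_ext (ext_coeff fun n => by
      rw [← fnL_apply (_ • _), map_smul, fnL_apply, coeff_smul_real]
      simp only [fn_const, coeff_toL2_const]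
      split_ifs <;> simp) }

theorem constL_apply (c : ℂ) : constL c = H2.const c := rfl

/-- A function in `H²(𝕋)` is its mean plus a continuous function that is controlled by its second
derivative. -/
theorem fn_eq (a : H2) :
    H2.fn a = toL2 (ContinuousMap.const Torus (meanL a) - invLap (H2.deriv2 a)) := by
  refine ext_coeff fun n => ?_
  rw [map_sub, map_sub, coeff_toL2_const, coeff_invLap, coeff_deriv2]
  by_cases hn : n = 0
  · subst hn
    simp [meanL, fnL_apply]
  · have : (n : ℂ) ≠ 0 := by exact_mod_cast hn
    rw [if_neg hn]
    field_simp
    ring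

/-- `invLap` as a bounded map from `L²(𝕋)` to `H²(𝕋)`. -/
theorem exists_lift : ∃ S : L2 →L[ℝ] H2, ∀ g, H2.fn (S g) = toL2 (invLap g) ∧
    H2.deriv2 (S g) = toL2 (ContinuousMap.const Torus (coeff 0 g)) - g := by
  -- The symbols of the first and second derivative of `invLap`: in · n⁻² = i/n, which is 0 at n = 0
  -- by convention, and in · i/n = -1 off n = 0.
  obtain ⟨T₁, h₁⟩ := exists_multiplier (fun n => Complex.I / n) 1 (fun n => by
    rw [norm_div, Complex.norm_I, Complex.norm_intCast]
    by_cases hn : n = 0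
    · simp [hn]
    · have : (1 : ℝ) ≤ |(n : ℝ)| := by exact_mod_cast Int.one_le_abs hn
      exact div_le_one_of_le₀ this (abs_nonneg _))
  obtain ⟨T₂, h₂⟩ := exists_multiplier (fun n => if n = 0 then 0 else -1) 1 (fun n => by
    split_ifs <;> simp)
  let T : L2 →L[ℝ] PiLp 2 (fun _ : Fin 3 => L2) :=
    ((PiLp.continuousLinearEquiv 2 ℝ (fun _ : Fin 3 => L2)).symm :
      (Fin 3 → L2) →L[ℝ] PiLp 2 (fun _ : Fin 3 => L2)).comp
    (ContinuousLinearMap.pi ![(toL2.comp invLap).restrictScalars ℝ, T₁.restrictScalars ℝ,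
      T₂.restrictScalars ℝ])
  have hT : ∀ g, T g ∈ H2 := by
    intro g
    constructor
    · change IsWeakDeriv (toL2 (invLap g)) (T₁ g)
      rw [isWeakDeriv_iff]
      intro n
      rw [h₁, coeff_invLap]
      by_cases hn : n = 0
      · simp [hn]
      · have : (n : ℂ) ≠ 0 := by exact_mod_cast hn
        field_simp
    · change IsWeakDeriv (T₁ g) (T₂ g)
      rw [isWeakDeriv_iff]
      intro n
      rw [h₁, h₂]
      by_cases hn : n = 0
      · simp [hn]
      · have : (n : ℂ) ≠ 0 := by exact_mod_cast hn
        rw [if_neg hn]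
        field_simp
        rw [Complex.I_sq]
        ring
  refine ⟨T.codRestrict H2 hT, fun g => ⟨rfl, ?_⟩⟩
  change T₂ g = _
  refine ext_coeff fun n => ?_
  rw [h₂, map_sub, coeff_toL2_const]
  split_ifs with hn
  · subst hn; simp
  · ring

/-! ### Constant solutions -/

/-- The left-hand side of the equation at the constant `c`. -/
def constEq (κ f ζ : ℝ) (c : ℂ) : ℂ :=
  c * (((ζ - ‖c‖ ^ 2 : ℝ) : ℂ) - Complex.I * ((1 + κ * ‖c‖ ^ 2 : ℝ) : ℂ)) + Complex.I * f

theorem isSolution_const_iff {d κ f ζ : ℝ} {c : ℂ} :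
    IsSolution d κ f ζ (H2.const c) ↔ constEq κ f ζ c = 0 := by
  have h1 : ∀ᵐ x ∂torusMeasure, H2.fn (H2.const c) x = c :=
    Lp.coeFn_const (p := 2) (μ := torusMeasure) c
  have h2 : ∀ᵐ x ∂torusMeasure, H2.deriv2 (H2.const c) x = 0 := by
    rw [deriv2_const]
    exact Lp.coeFn_zero ℂ 2 torusMeasure
  have e : ∀ᵐ x ∂torusMeasure,
      (-(d : ℂ) * H2.deriv2 (H2.const c) x - (Complex.I - ζ) * H2.fn (H2.const c) x
      - (1 + Complex.I * κ) * ((‖H2.fn (H2.const c) x‖ ^ 2 : ℝ) : ℂ) * H2.fn (H2.const c) x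
        + Complex.I * f = constEq κ f ζ c) := by
    filter_upwards [h1, h2] with x hx hy
    rw [hx, hy, constEq]
    push_cast
    ring
  constructor
  · intro h
    obtain ⟨x, hx, hy⟩ := (h.and e).exists
    exact hy.symm.trans hx
  · intro h
    filter_upwards [e] with x hx
    rw [hx, h]

theorem mem_constSolutions_iff {d κ f : ℝ} {p : H2 × ℝ} :
    p ∈ constSolutions d κ f ↔ ∃ c, p.1 = H2.const c ∧ constEq κ f p.2 c = 0 := by
  constructor
  · rintro ⟨h, c, hc⟩
    refine ⟨c, hc, ?_⟩
    rw [← isSolution_const_iff (d := d), ← hc]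
    exact h
  · rintro ⟨c, hc, h⟩
    refine ⟨?_, c, hc⟩
    change IsSolution d κ f p.2 p.1
    rw [hc, isSolution_const_iff]
    exact h

theorem const_mem_constSolutions_iff {d κ f ζ : ℝ} {c : ℂ} :
    (H2.const c, ζ) ∈ constSolutions d κ f ↔ constEq κ f ζ c = 0 := by
  rw [mem_constSolutions_iff]
  exact ⟨fun ⟨b, hb, h⟩ => const_injective hb ▸ h, fun h => ⟨c, rfl, h⟩⟩

theorem ne_zero_of_constEq {κ f ζ : ℝ} {c : ℂ} (hf : f ≠ 0) (h : constEq κ f ζ c = 0) : c ≠ 0 := by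
  rintro rfl
  simp [constEq, hf] at h

theorem normSq_of_constEq {κ f ζ : ℝ} {c : ℂ} (h : constEq κ f ζ c = 0) :
    ‖c‖ ^ 2 * ((ζ - ‖c‖ ^ 2) ^ 2 + (1 + κ * ‖c‖ ^ 2) ^ 2) = f ^ 2 := by
  have h1 : c * (((ζ - ‖c‖ ^ 2 : ℝ) : ℂ) - Complex.I * ((1 + κ * ‖c‖ ^ 2 : ℝ) : ℂ))
      = -(Complex.I * f) := eq_neg_of_add_eq_zero_left h
  have h2 := congrArg Complex.normSq h1
  rw [Complex.normSq_mul, Complex.normSq_neg, Complex.normSq_mul, Complex.normSq_eq_norm_sq c,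
    Complex.normSq_I, Complex.normSq_ofReal, one_mul] at h2
  rw [Complex.normSq_apply] at h2
  simp only [Complex.sub_re, Complex.sub_im, Complex.ofReal_re, Complex.ofReal_im, Complex.mul_re,
    Complex.mul_im, Complex.I_re, Complex.I_im] at h2
  linarith

/-! ### The curve of constant solutions -/

theorem exists_cubic_inverse {κ : ℝ} (hκ : 0 < κ) :
    ∃ h : ℝ → ℝ, ContDiff ℝ ∞ h ∧ ∀ y, h y + κ * h y ^ 3 = y := by
  have hmono : StrictMono fun x : ℝ => x + κ * x ^ 3 :=
    strictMono_id.add_monotone ((Odd.strictMono_pow (by decide)).monotone.const_mul hκ.le)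
  have hcont : Continuous fun x : ℝ => x + κ * x ^ 3 := by fun_prop
  have hsurj : Function.Surjective fun x : ℝ => x + κ * x ^ 3 := by
    apply hcont.surjective
    · refine Filter.tendsto_atTop_mono' _ ?_ Filter.tendsto_id
      filter_upwards [Filter.eventually_ge_atTop 0] with x hx
      have : 0 ≤ κ * x ^ 3 := by positivity
      simpa using this
    · refine Filter.tendsto_atBot_mono' _ ?_ Filter.tendsto_id
      filter_upwards [Filter.eventually_le_atBot 0] with x hx
      have : κ * x ^ 3 ≤ 0 := mul_nonpos_of_nonneg_of_nonpos hκ.le (Odd.pow_nonpos (by decide) hx)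
      simpa using this
  let e : ℝ ≃ₜ ℝ := (StrictMono.orderIsoOfSurjective _ hmono hsurj).toHomeomorph
  have he : ∀ x, e x = x + κ * x ^ 3 := fun x => rfl
  refine ⟨e.symm, ?_, fun y => ?_⟩
  · refine e.contDiff_symm_deriv (f' := fun x => 1 + κ * (3 * x ^ 2)) (fun x => by positivity)
      (fun x => ?_) ?_
    · have := (hasDerivAt_id x).add (((hasDerivAt_id x).pow 3).const_mul κ)
      refine this.congr_deriv ?_
      simp
    · change ContDiff ℝ ∞ fun x : ℝ => x + κ * x ^ 3
      fun_prop
  · rw [← he, e.apply_symm_apply]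

theorem eq_of_cubic_eq {κ A B : ℝ} (hκ : 0 < κ) (hA : 0 ≤ A) (hB : 0 ≤ B)
    (h : A * (1 + κ * A) ^ 2 = B * (1 + κ * B) ^ 2) : A = B := by
  have key : ∀ {x y : ℝ}, 0 ≤ x → x < y → x * (1 + κ * x) ^ 2 < y * (1 + κ * y) ^ 2 := by
    intro x y hx hxy
    have : 0 < 1 + κ * x := by positivity
    exact mul_lt_mul hxy (by gcongr) (by positivity) (by linarith)
  rcases lt_trichotomy A B with h1 | h1 | h1
  · exact absurd h (key hA h1).ne
  · exact h1
  · exact absurd h (key hB h1).ne'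

/-- The squared modulus and the curve parameter determine a constant solution. -/
theorem constEq_iff {κ f ζ : ℝ} {c : ℂ} (hκ : 0 < κ) :
    constEq κ f ζ c = 0 ↔ c = -(Complex.I * f) /
      (((1 + κ * ‖c‖ ^ 2 : ℝ) : ℂ) *
        ((((ζ - ‖c‖ ^ 2) / (1 + κ * ‖c‖ ^ 2) : ℝ) : ℂ) - Complex.I)) := by
  have h1 : (0 : ℝ) < 1 + κ * ‖c‖ ^ 2 := by positivity
  have h2 : (((1 + κ * ‖c‖ ^ 2 : ℝ) : ℂ) *
        ((((ζ - ‖c‖ ^ 2) / (1 + κ * ‖c‖ ^ 2) : ℝ) : ℂ) - Complex.I))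
      = ((ζ - ‖c‖ ^ 2 : ℝ) : ℂ) - Complex.I * ((1 + κ * ‖c‖ ^ 2 : ℝ) : ℂ) := by
    rw [mul_sub, ← Complex.ofReal_mul, mul_div_cancel₀ _ h1.ne', mul_comm Complex.I]
  rw [h2, eq_div_iff, constEq, add_eq_zero_iff_eq_neg]
  intro h
  have := congrArg Complex.im h
  simp only [Complex.sub_im, Complex.ofReal_re, Complex.ofReal_im, Complex.mul_im, Complex.I_re,
    Complex.I_im, Complex.zero_im] at this
  linarith

/-- The parameter is t = (ζ - A)/(1 + κA) with A = |c|². It avoids the folds that the curve may have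
over the ζ-axis. -/
theorem constSolutions_curve (d f : ℝ) {κ : ℝ} (hκ : 0 < κ) :
    (∃ γ : ℝ → H2 × ℝ, ContDiff ℝ ∞ γ ∧ (∀ t, deriv γ t ≠ 0) ∧ Topology.IsEmbedding γ ∧
        range γ = constSolutions d κ f) ∧
      ¬ Bornology.IsBounded (constSolutions d κ f) ∧
      ¬ Bornology.IsBounded (Prod.snd '' constSolutions d κ f) := by
  obtain ⟨h, hh, hinv⟩ := exists_cubic_inverse hκ
  -- Solves A(1 + κA)² = f²/(1 + t²): with A = x² this is the square of x + κx³ = f/√(1 + t²).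
  let A : ℝ → ℝ := fun t => h (f / √(1 + t ^ 2)) ^ 2
  have hA0 : ∀ t, 0 ≤ A t := fun t => sq_nonneg _
  have hAeq : ∀ t, A t * (1 + κ * A t) ^ 2 = f ^ 2 / (1 + t ^ 2) := by
    intro t
    have h1 := hinv (f / √(1 + t ^ 2))
    have h2 : f ^ 2 / (1 + t ^ 2) = (f / √(1 + t ^ 2)) ^ 2 := by
      rw [div_pow, Real.sq_sqrt (by positivity)]
    rw [h2]
    simp only [A]
    generalize f / √(1 + t ^ 2) = y at h1 ⊢
    linear_combination (h y + κ * h y ^ 3 + y) * h1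
  have hAsmooth : ContDiff ℝ ∞ A := by
    refine (hh.comp ?_).pow 2
    refine contDiff_const.div (ContDiff.sqrt (by fun_prop) fun t => by positivity) fun t => ?_
    positivity
  have hpos : ∀ t, 0 < 1 + κ * A t := fun t => by have := hA0 t; positivity
  have hden : ∀ t, ((1 + κ * A t : ℝ) : ℂ) * ((t : ℂ) - Complex.I) ≠ 0 := by
    intro t
    refine mul_ne_zero (by exact_mod_cast (hpos t).ne') fun h0 => ?_
    simpa using congrArg Complex.im h0
  let c : ℝ → ℂ := fun t => -(Complex.I * f) / (((1 + κ * A t : ℝ) : ℂ) * ((t : ℂ) - Complex.I))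
  have hc : ∀ t, ‖c t‖ ^ 2 = A t := by
    intro t
    have h1 : ‖(t : ℂ) - Complex.I‖ ^ 2 = 1 + t ^ 2 := by
      rw [← Complex.normSq_eq_norm_sq, Complex.normSq_apply]
      simp
      ring
    simp only [c]
    rw [norm_div, norm_neg, norm_mul, norm_mul, Complex.norm_I, one_mul, div_pow, mul_pow, h1,
      Complex.norm_real, Complex.norm_real, norm_eq_abs, norm_eq_abs, sq_abs, sq_abs,
      div_eq_iff (by have := hpos t; positivity), ← mul_assoc, hAeq, div_mul_cancel₀]
    positivity
  let γ : ℝ → H2 × ℝ := fun t => (constL (c t), A t + (1 + κ * A t) * t)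
  have hAc : ContDiff ℝ ∞ fun t => ((1 + κ * A t : ℝ) : ℂ) :=
    Complex.ofRealCLM.contDiff.comp (contDiff_const.add (contDiff_const.mul hAsmooth))
  have hγ : ContDiff ℝ ∞ γ := by
    refine (constL.contDiff.comp ?_).prodMk (by fun_prop)
    simp only [c, div_eq_mul_inv]
    exact contDiff_const.mul
      ((hAc.mul (Complex.ofRealCLM.contDiff.sub contDiff_const)).inv hden)
  -- A smooth left inverse of the curve, defined on all of H² × ℝ through the mean. It yields both
  -- the embedding property and, by the chain rule, the nonvanishing of the derivative.
  let ρ : H2 × ℝ → ℝ := fun p => (p.2 - ‖meanL p.1‖ ^ 2) / (1 + κ * ‖meanL p.1‖ ^ 2)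
  have hρ : ContDiff ℝ ∞ ρ := by
    have h1 : ContDiff ℝ ∞ fun p : H2 × ℝ => ‖meanL p.1‖ ^ 2 :=
      (meanL.contDiff.comp contDiff_fst).norm_sq ℝ
    exact (contDiff_snd.sub h1).div (contDiff_const.add (contDiff_const.mul h1))
      fun p => by positivity
  have hinvρ : Function.LeftInverse ρ γ := by
    intro t
    simp only [ρ, γ, constL_apply, meanL_const, hc, add_sub_cancel_left]
    exact mul_div_cancel_left₀ _ (hpos t).ne'
  have hmem : range γ = constSolutions d κ f := by
    ext p
    rw [mem_constSolutions_iff]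
    constructor
    · rintro ⟨t, rfl⟩
      refine ⟨c t, rfl, ?_⟩
      rw [constEq_iff hκ, hc]
      simp only [γ, add_sub_cancel_left]
      rw [mul_div_cancel_left₀ _ (hpos t).ne']
    · rintro ⟨b, hb, hζ⟩
      have h0 : (0 : ℝ) < 1 + κ * ‖b‖ ^ 2 := by positivity
      have hbA : ‖b‖ ^ 2 = A (ρ p) := by
        refine eq_of_cubic_eq hκ (by positivity) (hA0 _) ?_
        rw [hAeq]
        have := normSq_of_constEq hζ
        simp only [ρ, hb, meanL_const]
        rw [← this]
        field_simp
        ring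
      refine ⟨ρ p, Prod.ext ?_ ?_⟩
      · change H2.const (c (ρ p)) = p.1
        rw [hb]
        congr 1
        rw [constEq_iff hκ] at hζ
        rw [hζ]
        simp only [c]
        rw [← hbA]
        simp only [ρ, hb, meanL_const]
      · change A (ρ p) + (1 + κ * A (ρ p)) * ρ p = p.2
        rw [← hbA]
        simp only [ρ, hb, meanL_const]
        field_simp
        ring
  have hunb : ¬ Bornology.IsBounded (Prod.snd '' constSolutions d κ f) := by
    intro hb
    obtain ⟨C, hC⟩ := hb.exists_norm_le
    have h1 : ∀ t, γ t ∈ constSolutions d κ f := fun t => hmem ▸ mem_range_self t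
    have h2 := hC _ (mem_image_of_mem _ (h1 (|C| + 1)))
    have h3 : |C| + 1 ≤ A (|C| + 1) + (1 + κ * A (|C| + 1)) * (|C| + 1) := by
      have := hA0 (|C| + 1)
      have : 0 ≤ κ * A (|C| + 1) * (|C| + 1) := by positivity
      nlinarith
    have h4 : A (|C| + 1) + (1 + κ * A (|C| + 1)) * (|C| + 1) ≤ C :=
      (le_abs_self _).trans h2
    linarith [le_abs_self C]
  refine ⟨⟨γ, hγ, fun t h0 => ?_, hinvρ.isEmbedding hρ.continuous hγ.continuous, hmem⟩,
    fun hb => hunb hb.image_snd, hunb⟩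
  have h1 := (hγ.differentiable (by simp) t).hasDerivAt
  have h2 := (hρ.differentiable (by simp) (γ t)).hasFDerivAt.comp_hasDerivAt t h1
  rw [h0, map_zero, hinvρ.comp_eq_id] at h2
  exact zero_ne_one (h2.unique (hasDerivAt_id t))

/-! ### The threshold -/

theorem mul_sq_lt_one {k : ℝ} (hk : k ∈ Ico 0 (1 / √3)) : 0 < 1 - 3 * k ^ 2 := by
  have h1 : k ^ 2 < (1 / √3) ^ 2 := by gcongr; exacts [hk.1, hk.2]
  rw [div_pow, Real.sq_sqrt (by norm_num)] at h1
  linarith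

theorem lt_one_div_sqrt_three {k : ℝ} (h : 0 < 1 - 3 * k ^ 2) : k < 1 / √3 := by
  refine lt_of_pow_lt_pow_left₀ 2 (by positivity) ?_
  rw [div_pow, Real.sq_sqrt (by norm_num)]
  linarith

/-- The larger root `A` of `(1 - 3k²)A² - 4kA - 1`. -/
def discRoot (k : ℝ) : ℝ := (2 * k + √(1 + k ^ 2)) / (1 - 3 * k ^ 2)

/-- This explains the threshold: for A = |c|² the constant equation gives f² = A((ζ - A)² + (1 +
κA)²), which is smallest at ζ = A, and `discRoot` is the least A ≥ 0 with nonnegative discriminant.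
-/
theorem thresholdFun_eq {k : ℝ} (hk : 0 < 1 - 3 * k ^ 2) :
    thresholdFun k = discRoot k * (1 + k * discRoot k) ^ 2 := by
  have h : 1 + k * ((2 * k + √(1 + k ^ 2)) / (1 - 3 * k ^ 2))
      = (1 - k ^ 2 + k * √(1 + k ^ 2)) / (1 - 3 * k ^ 2) := by
    rw [eq_div_iff hk.ne', add_mul, mul_assoc, div_mul_cancel₀ _ hk.ne']
    ring
  rw [thresholdFun, discRoot, h, div_pow, div_mul_div_comm, div_mul_eq_mul_div, ← pow_succ']

theorem discRoot_pos {k : ℝ} (h0 : 0 ≤ k) (hk : 0 < 1 - 3 * k ^ 2) : 0 < discRoot k := by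
  rw [discRoot]
  positivity

theorem discRoot_lt {k l : ℝ} (h0 : 0 ≤ k) (hkl : k < l) (hl : 0 < 1 - 3 * l ^ 2) :
    discRoot k < discRoot l := by
  have h1 : k ^ 2 < l ^ 2 := by gcongr
  rw [discRoot, discRoot]
  have : 0 ≤ 2 * l + √(1 + l ^ 2) := by have := h0.trans_lt hkl; positivity
  exact div_lt_div₀ (by gcongr) (by linarith) this hl

theorem thresholdFun_strictMonoOn : StrictMonoOn thresholdFun (Ico 0 (1 / √3)) := by
  intro k hk l hl hkl
  rw [thresholdFun_eq (mul_sq_lt_one hk), thresholdFun_eq (mul_sq_lt_one hl)]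
  have h1 := discRoot_lt hk.1 hkl (mul_sq_lt_one hl)
  have h2 := discRoot_pos hk.1 (mul_sq_lt_one hk)
  have h3 := hk.1
  have h4 : 0 < l := hk.1.trans_lt hkl
  exact mul_lt_mul h1 (by gcongr) (by positivity) (h2.trans h1).le

theorem thresholdFun_zero : thresholdFun 0 = 1 := by simp [thresholdFun]

theorem continuousOn_thresholdFun : ContinuousOn thresholdFun (Ico 0 (1 / √3)) := by
  unfold thresholdFun
  refine ContinuousOn.mul (ContinuousOn.div (by fun_prop) (by fun_prop) fun k hk => ?_)
    (by fun_prop)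
  exact pow_ne_zero _ (mul_sq_lt_one hk).ne'

theorem exists_thresholdFun_eq {f : ℝ} (hf : 1 < f ^ 2) :
    ∃ k ∈ Ioo 0 (1 / √3), thresholdFun k = f ^ 2 := by
  have h0 : 0 < f ^ 2 := by linarith
  have h1 : 1 / f ^ 2 < 1 := (div_lt_one h0).2 hf
  -- Chosen so that 1 - 3l² = 1/f². Then `discRoot l` is already at least f², which gives the upper
  -- end for the intermediate value theorem.
  set l : ℝ := √((1 - 1 / f ^ 2) / 3) with hl
  have hl2 : 1 - 3 * l ^ 2 = 1 / f ^ 2 := by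
    rw [hl, Real.sq_sqrt (by linarith)]
    ring
  have hl0 : 0 < l := Real.sqrt_pos.2 (by linarith)
  have hl3 : l < 1 / √3 := lt_one_div_sqrt_three (hl2 ▸ by positivity)
  have hlm : l ∈ Ico 0 (1 / √3) := ⟨hl0.le, hl3⟩
  have hroot : f ^ 2 ≤ discRoot l := by
    rw [discRoot, hl2, div_div_eq_mul_div, div_one]
    have : 1 ≤ √(1 + l ^ 2) := Real.one_le_sqrt.2 (by nlinarith)
    nlinarith
  have hle : f ^ 2 ≤ thresholdFun l := by
    rw [thresholdFun_eq (mul_sq_lt_one hlm)]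
    have h2 : 0 < discRoot l := by linarith
    have h3 : 1 ≤ (1 + l * discRoot l) ^ 2 := one_le_pow₀ (by nlinarith [mul_pos hl0 h2])
    nlinarith
  obtain ⟨k, hk, hkf⟩ := intermediate_value_Icc hl0.le
    (continuousOn_thresholdFun.mono fun x hx => ⟨hx.1, hx.2.trans_lt hl3⟩)
    (show f ^ 2 ∈ Icc (thresholdFun 0) (thresholdFun l) from
      ⟨thresholdFun_zero ▸ hf.le, hle⟩)
  refine ⟨k, ⟨hk.1.lt_of_ne ?_, hk.2.trans_lt hl3⟩, hkf⟩
  rintro rfl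
  rw [thresholdFun_zero] at hkf
  linarith

theorem kappaStar_spec {f : ℝ} (hf : 1 < f ^ 2) : IsGreatest (thresholdSet f) (kappaStar f) ∧
    ∀ k ∈ Ioo 0 (1 / √3), thresholdFun k = f ^ 2 ↔ k = kappaStar f := by
  obtain ⟨l, hl, hlf⟩ := exists_thresholdFun_eq hf
  have hg : IsGreatest (thresholdSet f) l := by
    refine ⟨⟨hl, hlf.le⟩, fun k hk => ?_⟩
    by_contra! h
    have := thresholdFun_strictMonoOn (Ioo_subset_Ico_self hl) (Ioo_subset_Ico_self hk.1) h
    linarith [hk.2]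
  have he : kappaStar f = l := by
    rw [kappaStar, if_pos hf, hg.csSup_eq]
  rw [he]
  refine ⟨hg, fun k hk => ⟨fun h => ?_, fun h => h ▸ hlf⟩⟩
  exact thresholdFun_strictMonoOn.injOn (Ioo_subset_Ico_self hk) (Ioo_subset_Ico_self hl)
    (h.trans hlf.symm)

/-- A nonnegative discriminant at a constant solution forces `κ` below the threshold. -/
theorem le_kappaStar_of_disc_nonneg {κ f ζ : ℝ} {c : ℂ} (hκ : 0 < κ) (h : constEq κ f ζ c = 0)
    (hD : 0 ≤ disc κ c) : κ ≤ kappaStar f := by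
  set A := ‖c‖ ^ 2 with hA
  have hA0 : 0 ≤ A := sq_nonneg _
  have hD' : 0 ≤ (1 - 3 * κ ^ 2) * A ^ 2 - 4 * κ * A - 1 := by
    have : A ^ 2 = ‖c‖ ^ 4 := by rw [hA]; ring
    rw [this]
    exact hD
  have hpos : 0 < 1 - 3 * κ ^ 2 := by
    by_contra! hneg
    nlinarith [mul_nonneg hκ.le hA0, mul_nonpos_of_nonpos_of_nonneg hneg (sq_nonneg A)]
  have hmem : κ ∈ Ico 0 (1 / √3) := ⟨hκ.le, lt_one_div_sqrt_three hpos⟩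
  have hroot : discRoot κ ≤ A := by
    rw [discRoot, div_le_iff₀ hpos]
    have h1 : √(1 + κ ^ 2) ^ 2 = 1 + κ ^ 2 := Real.sq_sqrt (by positivity)
    have h2 : 0 ≤ √(1 + κ ^ 2) := Real.sqrt_nonneg _
    -- Completing the square: (1 - 3κ²) times the discriminant equals the right side minus the left
    -- side. The sign in `h4` then excludes the negative root.
    have h3 : √(1 + κ ^ 2) ^ 2 ≤ (A * (1 - 3 * κ ^ 2) - 2 * κ) ^ 2 := by nlinarith
    have h4 : 0 ≤ A * (1 - 3 * κ ^ 2) - 2 * κ := by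
      by_contra! hneg
      nlinarith [mul_nonneg hκ.le hA0]
    linarith [le_of_sq_le_sq h3 h4]
  have hle : thresholdFun κ ≤ f ^ 2 := by
    rw [thresholdFun_eq hpos]
    have h1 := discRoot_pos hκ.le hpos
    calc discRoot κ * (1 + κ * discRoot κ) ^ 2 ≤ A * (1 + κ * A) ^ 2 := by gcongr
      _ ≤ A * ((ζ - A) ^ 2 + (1 + κ * A) ^ 2) := by nlinarith [mul_nonneg hA0 (sq_nonneg (ζ - A))]
      _ = f ^ 2 := normSq_of_constEq h
  -- Forces f² > 1, so that `kappaStar` is the maximum of `thresholdSet` and not the default value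
  -- 0.
  have hgt : 1 < thresholdFun κ := by
    rw [← thresholdFun_zero]
    exact thresholdFun_strictMonoOn ⟨le_rfl, by positivity⟩ hmem hκ
  exact (kappaStar_spec (hgt.trans_le hle)).1.2 ⟨⟨hκ, hmem.2⟩, hle⟩

/-! ### Rigidity of constant solutions with negative discriminant -/

theorem norm_one_add_I_mul (κ : ℝ) : ‖(1 : ℂ) + Complex.I * κ‖ = √(1 + κ ^ 2) := by
  rw [← Real.sqrt_sq (norm_nonneg _), ← Complex.normSq_eq_norm_sq, Complex.normSq_apply]
  congr 1
  simp
  ring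

/-- Coercivity constant of the imaginary part of the equation around the constant `m`, for
perturbations bounded by `δ`. -/
def coercivity (κ m δ : ℝ) : ℝ :=
  1 + 2 * κ * m ^ 2 - √(1 + κ ^ 2) * (m ^ 2 + 3 * m * δ + δ ^ 2)

/-- With A = |c|², (1 + 2κA)² - (1 + κ²)A² is exactly the negative of the discriminant. -/
theorem coercivity_pos {κ : ℝ} (hκ : 0 < κ) {c : ℂ} (hD : disc κ c < 0) :
    0 < coercivity κ ‖c‖ 0 := by
  rw [disc] at hD
  set A := ‖c‖ ^ 2 with hA
  have hA0 : 0 ≤ A := sq_nonneg _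
  have h1 : ‖c‖ ^ 4 = A ^ 2 := by rw [hA]; ring
  rw [h1] at hD
  have h2 : √(1 + κ ^ 2) ^ 2 = 1 + κ ^ 2 := Real.sq_sqrt (by positivity)
  have h3 : √(1 + κ ^ 2) * A < 1 + 2 * κ * A := by
    refine lt_of_pow_lt_pow_left₀ 2 (by positivity) ?_
    rw [mul_pow, h2]
    nlinarith
  simp only [coercivity, mul_zero, zero_pow two_ne_zero, add_zero, ← hA]
  linarith

/-- The imaginary part of the equation at a point, tested with `w`. -/
theorem coercivity_mul_le {d κ f ζ δ : ℝ} {m w u : ℂ} (hδ : ‖w‖ ≤ δ)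
    (h : -(d : ℂ) * u - (Complex.I - ζ) * (m + w)
      - (1 + Complex.I * κ) * ((‖m + w‖ ^ 2 : ℝ) : ℂ) * (m + w) + Complex.I * f = 0) :
    coercivity κ ‖m‖ δ * ‖w‖ ^ 2 ≤ (conj w * (-(d : ℂ) * u + (-(Complex.I - ζ) * m
      - (1 + Complex.I * κ) * (m * conj m) * m + Complex.I * f))).im := by
  -- The part of |m + w|²(m + w) left after removing |m|²m and 2|m|²w. The term 2|m|²w contributes
  -- with a definite sign and is kept exactly; r is only estimated.
  set r : ℂ := m ^ 2 * conj w + (2 * m * (w * conj w) + conj m * w ^ 2) + w ^ 2 * conj w with hr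
  have hnn : ∀ z : ℂ, ((‖z‖ ^ 2 : ℝ) : ℂ) = z * conj z := fun z => by
    rw [Complex.mul_conj, Complex.normSq_eq_norm_sq]
  have e1 : conj w * (-(d : ℂ) * u + (-(Complex.I - ζ) * m
      - (1 + Complex.I * κ) * (m * conj m) * m + Complex.I * f))
      = (Complex.I - ζ + 2 * (1 + Complex.I * κ) * ((‖m‖ ^ 2 : ℝ) : ℂ)) * ((‖w‖ ^ 2 : ℝ) : ℂ)
        + (1 + Complex.I * κ) * (r * conj w) := by
    rw [hnn, map_add] at h
    rw [hnn, hnn, hr]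
    linear_combination conj w * h
  have e2 : ((Complex.I - ζ + 2 * (1 + Complex.I * κ) * ((‖m‖ ^ 2 : ℝ) : ℂ))
      * ((‖w‖ ^ 2 : ℝ) : ℂ)).im = (1 + 2 * κ * ‖m‖ ^ 2) * ‖w‖ ^ 2 := by
    rw [Complex.im_mul_ofReal, Complex.add_im, Complex.im_mul_ofReal]
    simp
  have hw0 := norm_nonneg w
  have hm0 := norm_nonneg m
  have hr' : ‖r‖ ≤ ‖m‖ ^ 2 * ‖w‖ + (2 * ‖m‖ * (‖w‖ * ‖w‖) + ‖m‖ * ‖w‖ ^ 2) + ‖w‖ ^ 2 * ‖w‖ := by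
    refine (norm_add₃_le).trans (add_le_add_three ?_ ((norm_add_le _ _).trans ?_) ?_) <;> simp
  have hr2 : ‖r‖ ≤ (‖m‖ ^ 2 + 3 * ‖m‖ * δ + δ ^ 2) * ‖w‖ := by
    have : ‖w‖ ^ 2 ≤ δ ^ 2 := by gcongr
    nlinarith [mul_nonneg hm0 hw0, mul_le_mul_of_nonneg_left hδ (mul_nonneg hm0 hw0)]
  have e3 : ‖(1 + Complex.I * κ) * (r * conj w)‖
      ≤ √(1 + κ ^ 2) * ((‖m‖ ^ 2 + 3 * ‖m‖ * δ + δ ^ 2) * ‖w‖ * ‖w‖) := by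
    rw [norm_mul, norm_mul, norm_one_add_I_mul, RCLike.norm_conj]
    gcongr
  have e4 := (Complex.abs_im_le_norm _).trans e3
  rw [e1, Complex.add_im, e2, coercivity]
  linarith [neg_le_of_abs_le e4]

/-- Mode by mode the product is -|â''(n)|²/n², which is real. It is integration by parts without the
first derivative. -/
theorem im_inner_deriv2 (a : H2) : (inner ℂ (toL2 (-invLap (H2.deriv2 a))) (H2.deriv2 a)).im = 0 := by
  have h := Complex.hasSum_im (hasSum_coeff_mul (toL2 (-invLap (H2.deriv2 a))) (H2.deriv2 a))
  refine h.unique ?_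
  convert hasSum_zero using 2 with n
  rw [map_neg, map_neg, coeff_invLap]
  simp only [map_neg, map_div₀, map_pow, map_intCast]
  rw [← neg_div, div_mul_eq_mul_div, neg_mul, mul_comm, Complex.mul_conj]
  have : -(Complex.normSq (coeff n (H2.deriv2 a)) : ℂ) / (n : ℂ) ^ 2
      = ((-Complex.normSq (coeff n (H2.deriv2 a)) / (n : ℝ) ^ 2 : ℝ) : ℂ) := by push_cast; rfl
  rw [this, Complex.ofReal_im]

/-- The sup norm of the mean-free part w is at most that of `invLap (H2.deriv2 a)`, so the pointwise
estimate `coercivity_mul_le` applies everywhere. Integrating it gives η‖w‖² ≤ 0 with η > 0. -/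
theorem eq_const_of_coercivity_pos {d κ f ζ : ℝ} {a : H2} (ha : IsSolution d κ f ζ a)
    (hpos : 0 < coercivity κ ‖meanL a‖ ‖invLap (H2.deriv2 a)‖) : a = H2.const (meanL a) := by
  set m := meanL a with hm
  set w : C(Torus, ℂ) := -invLap (H2.deriv2 a) with hw
  set η := coercivity κ ‖m‖ ‖invLap (H2.deriv2 a)‖
  have hfn : H2.fn a = toL2 (ContinuousMap.const Torus m + w) := by
    rw [fn_eq, ← hm, hw, sub_eq_add_neg]
  set K : ℂ := -(Complex.I - ζ) * m - (1 + Complex.I * κ) * (m * conj m) * m + Complex.I * f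
  have hw0 : coeff 0 (toL2 w) = 0 := by
    rw [hw, map_neg, map_neg, coeff_invLap]; simp
  -- The term iη w moves the coercive lower bound to the other side: the imaginary part of ⟨w, R⟩ is
  -- an integral of nonnegative values, yet equals -η‖w‖².
  set R : L2 := (-(d : ℂ)) • H2.deriv2 a + toL2 (ContinuousMap.const Torus K)
    - (Complex.I * η) • toL2 w with hR
  have hin : inner ℂ (toL2 w) (toL2 (ContinuousMap.const Torus K)) = 0 := by
    refine (hasSum_coeff_mul _ _).unique ?_
    convert hasSum_zero using 2 with n
    rw [coeff_toL2_const]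
    split_ifs with hn
    · subst hn; rw [hw0]; simp
    · simp
  have h1 : (inner ℂ (toL2 w) R).im = -(η * ‖toL2 w‖ ^ 2) := by
    rw [hR, inner_sub_right, inner_add_right, hin, inner_smul_right, inner_smul_right,
      inner_self_eq_norm_sq_to_K, add_zero, ← Complex.ofReal_neg, Complex.sub_im,
      Complex.im_ofReal_mul, hw, im_inner_deriv2, ← hw, mul_zero, zero_sub, mul_assoc,
      Complex.I_mul_im]
    change -(((η : ℂ) * ((‖toL2 w‖ : ℝ) : ℂ) ^ 2).re) = _
    rw [← Complex.ofReal_pow, ← Complex.ofReal_mul, Complex.ofReal_re]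
  have h2 : 0 ≤ (inner ℂ (toL2 w) R).im := by
    rw [MeasureTheory.L2.inner_def]
    have := integral_im (𝕜 := ℂ) (L2.integrable_inner (𝕜 := ℂ) (toL2 w) R)
    simp only [RCLike.im_to_complex] at this
    rw [← this]
    refine integral_nonneg_of_ae ?_
    filter_upwards [ha, ContinuousMap.coeFn_toLp (p := 2) (𝕜 := ℂ) torusMeasure w,
      ContinuousMap.coeFn_toLp (p := 2) (𝕜 := ℂ) torusMeasure (ContinuousMap.const Torus m + w),
      ContinuousMap.coeFn_toLp (p := 2) (𝕜 := ℂ) torusMeasure (ContinuousMap.const Torus K),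
      Lp.coeFn_sub ((-(d : ℂ)) • H2.deriv2 a + toL2 (ContinuousMap.const Torus K))
        ((Complex.I * η) • toL2 w),
      Lp.coeFn_add ((-(d : ℂ)) • H2.deriv2 a) (toL2 (ContinuousMap.const Torus K)),
      Lp.coeFn_smul (-(d : ℂ)) (H2.deriv2 a),
      Lp.coeFn_smul (Complex.I * η) (toL2 w)] with x h1 h2 h3 h4 h5 h6 h7 h8
    rw [hfn, h3] at h1
    have hδ : ‖w x‖ ≤ ‖invLap (H2.deriv2 a)‖ := by
      rw [← norm_neg (invLap _)]
      exact w.norm_coe_le_norm x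
    have key := coercivity_mul_le hδ h1
    rw [h2, hR, h5, Pi.sub_apply, h6, Pi.add_apply, h7, h8, Pi.smul_apply, Pi.smul_apply, h2, h4]
    simp only [smul_eq_mul, ContinuousMap.const_apply, RCLike.inner_apply]
    have e : ((-(d : ℂ) * H2.deriv2 a x + K - Complex.I * η * w x) * conj (w x)).im
        = (conj (w x) * (-(d : ℂ) * H2.deriv2 a x + K)).im - η * ‖w x‖ ^ 2 := by
      have : (-(d : ℂ) * H2.deriv2 a x + K - Complex.I * η * w x) * conj (w x)
        = conj (w x) * (-(d : ℂ) * H2.deriv2 a x + K)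
          - Complex.I * ((η * ‖w x‖ ^ 2 : ℝ) : ℂ) := by
        push_cast
        rw [← Complex.mul_conj']
        ring
      rw [this, Complex.sub_im, Complex.I_mul_im, Complex.ofReal_re]
    change 0 ≤ ((-(d : ℂ) * H2.deriv2 a x + K - Complex.I * η * w x) * conj (w x)).im
    rw [e]
    exact sub_nonneg.2 key
  have h3 : toL2 w = 0 := by
    rw [h1] at h2
    have h4 : ‖toL2 w‖ ^ 2 ≤ 0 := by nlinarith
    exact norm_eq_zero.1 (pow_eq_zero_iff two_ne_zero |>.1 (le_antisymm h4 (sq_nonneg _)))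
  refine H2_ext ?_
  rw [hfn, fn_const, map_add, h3, add_zero]

/-- The coercivity constant is continuous on H² × ℝ and positive at the given point, so rigidity
holds on an open neighbourhood. -/
theorem not_isBifurcationPoint_of_disc_neg {d κ f ζ : ℝ} {c : ℂ} (hκ : 0 < κ)
    (hD : disc κ c < 0) : ¬ IsBifurcationPoint d κ f (H2.const c, ζ) := by
  rintro ⟨-, hcl⟩
  have hcont : Continuous fun p : H2 × ℝ =>
      coercivity κ ‖meanL p.1‖ ‖invLap (deriv2L p.1)‖ := by
    unfold coercivity
    fun_prop
  have hopen : IsOpen {p : H2 × ℝ | 0 < coercivity κ ‖meanL p.1‖ ‖invLap (deriv2L p.1)‖} :=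
    isOpen_lt continuous_const hcont
  obtain ⟨p, hp, hsol, hnc⟩ := mem_closure_iff.1 hcl _ hopen (by
    simp only [mem_ofPred_eq, meanL_const, deriv2L_apply, deriv2_const, map_zero, norm_zero]
    exact coercivity_pos hκ hD)
  exact hnc ⟨hsol, _, eq_const_of_coercivity_pos hsol hp⟩

theorem not_isBifurcationPoint_of_kappaStar_lt {d κ f : ℝ} (hκ : 0 < κ) (h : kappaStar f < κ)
    {p : H2 × ℝ} (hp : p ∈ constSolutions d κ f) : ¬ IsBifurcationPoint d κ f p := by
  obtain ⟨c, hc, heq⟩ := mem_constSolutions_iff.1 hp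
  have hpe : p = (H2.const c, p.2) := Prod.ext hc rfl
  rw [hpe]
  refine not_isBifurcationPoint_of_disc_neg hκ ?_
  by_contra! hD
  exact absurd (le_kappaStar_of_disc_nonneg hκ heq hD) (not_le.2 h)

/-! ### Real-linear algebra of the Fourier modes -/

/-- The adjugate of z ↦ αz + βz̄ is z ↦ ᾱz - βz̄, and their composition is multiplication by the
determinant αᾱ - ββ̄ = 0. So the range of the adjugate lies in the kernel. The adjugate does not
vanish at both 1 and i, since α ≠ 0. -/
theorem exists_kernel {α β : ℂ} (hα : α ≠ 0) (h : α * conj α = β * conj β) :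
    ∃ φ : ℂ, φ ≠ 0 ∧ α * φ + β * conj φ = 0 := by
  by_cases h1 : conj α - β = 0
  · refine ⟨conj α * Complex.I - β * conj Complex.I, fun h2 => ?_, ?_⟩
    · rw [Complex.conj_I, ← sub_eq_zero.1 h1] at h2
      have : conj α * Complex.I = 0 := by linear_combination h2 / 2
      simp [hα] at this
    · simp only [map_sub, map_mul, map_neg, Complex.conj_conj, Complex.conj_I]
      linear_combination Complex.I * h
  · refine ⟨conj α - β, h1, ?_⟩
    simp only [map_sub, Complex.conj_conj]
    linear_combination h

/-- If `z ↦ αz + β z̄` has the kernel `ℝφ` then a perturbation `(α', β')` that is transversal to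
the vanishing of its determinant maps `φ` to a complement of the range. -/
theorem exists_decomposition {α β α' β' φ : ℂ} (hα : α ≠ 0) (h : α * conj α = β * conj β)
    (hφ : φ ≠ 0) (hker : α * φ + β * conj φ = 0) {δ : ℝ} (hδ : δ ≠ 0)
    (hdet : conj α * α' + α * conj α' - conj β * β' - β * conj β' = δ) (w : ℂ) :
    ∃ (r : ℝ) (z : ℂ), α * z + β * conj z + r * (α' * φ + β' * conj φ) = w := by
  have hα' : conj α ≠ 0 := by simpa using hα
  have hφ' : conj φ ≠ 0 := by simpa using hφ
  have hker' : conj α * conj φ + conj β * φ = 0 := by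
    simpa using congrArg conj hker
  -- The adjugate applied to w. It lies in the kernel, hence is a real multiple of φ, and it
  -- vanishes exactly on the range.
  set q : ℂ := conj α * w - β * conj w with hq
  have hq1 : α * q + β * conj q = 0 := by
    simp only [hq, map_sub, map_mul, Complex.conj_conj]
    linear_combination w * h
  have hreal : conj (q / φ) = q / φ := by
    rw [map_div₀, div_eq_div_iff hφ' hφ]
    apply mul_left_cancel₀ hα
    linear_combination conj q * hker - conj φ * hq1
  obtain ⟨r, hr⟩ := Complex.conj_eq_iff_real.1 hreal
  have hqr : q = r * φ := by rw [← hr, div_mul_cancel₀ _ hφ]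
  have hδ' : (δ : ℂ) ≠ 0 := by exact_mod_cast hδ
  -- The adjugate maps α'φ + β'φ̄ to δφ by `hdet` and the kernel equation, so this correction makes
  -- the adjugate of w' zero. For such w' the preimage w'/(2α) is explicit.
  set w' : ℂ := w - (r / δ : ℝ) * (α' * φ + β' * conj φ) with hw'
  have hw1 : conj α * w' = β * conj w' := by
    have h1 : conj w' = conj w - (r / δ : ℝ) * (conj α' * conj φ + conj β' * φ) := by
      simp only [hw', map_sub, map_mul, map_add, Complex.conj_conj, Complex.conj_ofReal]
    have h2 : ((r / δ : ℝ) : ℂ) * δ = r := by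
      push_cast
      field_simp
    rw [h1, hw']
    linear_combination hqr - hq - φ * h2 + ((r / δ : ℝ) : ℂ) * (-φ * hdet
      + conj α' * hker - β' * hker')
  refine ⟨r / δ, w' / (2 * α), ?_⟩
  rw [map_div₀, map_mul, map_ofNat]
  have h3 : α * (w' / (2 * α)) = w' / 2 := by field_simp
  have h4 : β * (conj w' / (2 * conj α)) = w' / 2 := by
    rw [← mul_div_assoc, ← hw1]
    field_simp
  rw [h3, h4, hw']
  ring

/-- Cramer's rule with the adjugate z ↦ ᾱz - βz̄; the determinant is real. -/
theorem solve_mode {α β : ℂ} (h : α * conj α - β * conj β ≠ 0) (w : ℂ) :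
    α * ((conj α * w - β * conj w) / (α * conj α - β * conj β))
      + β * conj ((conj α * w - β * conj w) / (α * conj α - β * conj β)) = w := by
  have e : conj (α * conj α - β * conj β) = α * conj α - β * conj β := by
    simp only [map_sub, map_mul, Complex.conj_conj]
    ring
  rw [map_div₀, e]
  simp only [map_sub, map_mul, Complex.conj_conj]
  field_simp
  ring

/-- The solution operators of the modes gain two derivatives uniformly. -/
theorem exists_bound_modes {d : ℝ} (hd : d ≠ 0) (α₀ β : ℂ) :
    ∃ C : ℝ, ∀ (n : ℤ) (w : ℂ),
      ‖(n : ℂ) ^ 2 * ((conj (d * (n : ℂ) ^ 2 + α₀) * w - β * conj w) /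
        ((d * (n : ℂ) ^ 2 + α₀) * conj (d * (n : ℂ) ^ 2 + α₀) - β * conj β))‖ ≤ C * ‖w‖ := by
  -- The determinant factors as (|α| - |β|)(|α| + |β|) and the adjugate has norm at most |α| + |β|,
  -- so B n bounds the mode. Singular modes are harmless because division by zero gives 0 on both
  -- sides.
  let B : ℤ → ℝ := fun n => (n : ℝ) ^ 2 / |‖d * (n : ℂ) ^ 2 + α₀‖ - ‖β‖|
  have hd' : 0 < |d| := abs_pos.2 hd
  -- For n² ≥ M the term |d|n² is at least twice |α₀| + |β|, so ||α| - |β|| is at least |d|n²/2 and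
  -- B n ≤ 2/|d|. Only finitely many n remain.
  set M : ℝ := 2 * (‖α₀‖ + ‖β‖) / |d| with hM
  have hfin : {n : ℤ | ¬ B n ≤ 2 / |d|}.Finite := by
    refine (Set.finite_Icc (-⌈M⌉) ⌈M⌉).subset fun n hn => ?_
    by_contra hn'
    apply hn
    have h1 : M ≤ (n : ℝ) ^ 2 := by
      have h2 : ⌈M⌉ < |n| := by
        rw [mem_Icc, ← abs_le] at hn'
        exact not_le.1 hn'
      have h3 : M < |(n : ℝ)| := by
        calc M ≤ (⌈M⌉ : ℝ) := Int.le_ceil M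
          _ < ((|n| : ℤ) : ℝ) := by exact_mod_cast h2
          _ = |(n : ℝ)| := by push_cast; rfl
      have h0 : n ≠ 0 := by
        rintro rfl
        have : 0 ≤ M := by positivity
        simp at h3
        linarith
      have h4 : (1 : ℝ) ≤ |(n : ℝ)| := by exact_mod_cast Int.one_le_abs h0
      rw [← sq_abs]
      nlinarith
    have h2 : |d| * (n : ℝ) ^ 2 - ‖α₀‖ ≤ ‖d * (n : ℂ) ^ 2 + α₀‖ := by
      have := norm_sub_norm_le (d * (n : ℂ) ^ 2) (-α₀)
      rw [sub_neg_eq_add, norm_neg, norm_mul, norm_pow, Complex.norm_intCast, Complex.norm_real,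
        Real.norm_eq_abs, sq_abs] at this
      exact this
    have h3 : |d| * (n : ℝ) ^ 2 / 2 ≤ |‖d * (n : ℂ) ^ 2 + α₀‖ - ‖β‖| := by
      have h4 : 2 * (‖α₀‖ + ‖β‖) ≤ (n : ℝ) ^ 2 * |d| := (div_le_iff₀ hd').1 h1
      have := le_abs_self (‖d * (n : ℂ) ^ 2 + α₀‖ - ‖β‖)
      linarith
    refine div_le_of_le_mul₀ (abs_nonneg _) (by positivity) ?_
    rw [div_mul_eq_mul_div, le_div_iff₀ hd']
    linarith
  have hbdd : BddAbove (range B) :=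
    Filter.IsBoundedUnder.bddAbove_range_of_cofinite ⟨2 / |d|, hfin⟩
  obtain ⟨C, hC⟩ := hbdd
  refine ⟨C, fun n w => ?_⟩
  set α : ℂ := d * (n : ℂ) ^ 2 + α₀ with hα
  have hden : ‖α * conj α - β * conj β‖ = |‖α‖ - ‖β‖| * (‖α‖ + ‖β‖) := by
    rw [Complex.mul_conj, Complex.mul_conj, ← Complex.ofReal_sub, Complex.norm_real,
      Complex.normSq_eq_norm_sq, Complex.normSq_eq_norm_sq, sq_sub_sq, norm_mul, mul_comm,
      Real.norm_eq_abs, Real.norm_eq_abs, abs_of_nonneg (by positivity : 0 ≤ ‖α‖ + ‖β‖)]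
  have hnum : ‖conj α * w - β * conj w‖ ≤ (‖α‖ + ‖β‖) * ‖w‖ := by
    refine (norm_sub_le _ _).trans ?_
    rw [norm_mul, norm_mul, RCLike.norm_conj, RCLike.norm_conj, add_mul]
  have hB : B n ≤ C := hC (mem_range_self n)
  rw [norm_mul, norm_div, hden, norm_pow, Complex.norm_intCast, sq_abs]
  calc (n : ℝ) ^ 2 * (‖conj α * w - β * conj w‖ / (|‖α‖ - ‖β‖| * (‖α‖ + ‖β‖)))
      ≤ (n : ℝ) ^ 2 * ((‖α‖ + ‖β‖) * ‖w‖ / (|‖α‖ - ‖β‖| * (‖α‖ + ‖β‖))) := by gcongr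
    _ = B n * ‖w‖ * ((‖α‖ + ‖β‖) / (‖α‖ + ‖β‖)) := by simp only [B]; rw [← hα, mul_div_mul_comm]; ring
    _ ≤ B n * ‖w‖ * 1 := by
        have : 0 ≤ B n := by positivity
        gcongr
        exact div_self_le_one _
    _ ≤ C * ‖w‖ := by rw [mul_one]; gcongr

/-! ### The linearisation at a constant solution -/

/-- Coefficient of the perturbation in the linearised equation, up to the term `d n²`. -/
def linA (κ ζ : ℝ) (c : ℂ) : ℂ := ζ - Complex.I - 2 * (1 + Complex.I * κ) * (c * conj c)

/-- Coefficient of the conjugate perturbation in the linearised equation. -/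
def linB (κ : ℝ) (c : ℂ) : ℂ := -((1 + Complex.I * κ) * c ^ 2)

/-- Derivative of `constEq` in the direction `(c', ζ')`. -/
def dConstEq (κ ζ : ℝ) (c c' : ℂ) (ζ' : ℝ) : ℂ :=
  c' * (ζ - Complex.I) + c * ζ' - (1 + Complex.I * κ) * (2 * (c * conj c) * c' + c ^ 2 * conj c')

/-- Derivative of `linA` in the direction `(c', ζ')`. -/
def dLinA (κ : ℝ) (c c' : ℂ) (ζ' : ℝ) : ℂ :=
  ζ' - 2 * (1 + Complex.I * κ) * (c' * conj c + c * conj c')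

/-- Derivative of `linB` in the direction `c'`. -/
def dLinB (κ : ℝ) (c c' : ℂ) : ℂ := -(2 * (1 + Complex.I * κ) * c * c')

/-- Taken at x = dn², this is the determinant of the n-th mode; its zeros are the source of k₁ and
k₂. -/
theorem det_eq (κ ζ x : ℝ) (c : ℂ) :
    (x + linA κ ζ c) * conj (x + linA κ ζ c) - linB κ c * conj (linB κ c)
      = (((x + ζ - 2 * ‖c‖ ^ 2) ^ 2 - disc κ c : ℝ) : ℂ) := by
  have hc : c * conj c = ((‖c‖ ^ 2 : ℝ) : ℂ) := by
    rw [Complex.mul_conj, Complex.normSq_eq_norm_sq]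
  have h4 : ‖c‖ ^ 4 = (‖c‖ ^ 2) ^ 2 := by ring
  rw [linA, linB, disc, hc, h4]
  generalize ‖c‖ ^ 2 = A at hc
  simp only [map_add, map_sub, map_neg, map_mul, map_pow, Complex.conj_I, Complex.conj_ofReal,
    map_one, map_ofNat]
  push_cast
  linear_combination (-(1 + Complex.I * κ) * (1 - Complex.I * κ) * (c * conj c + A)) * hc
    + (-4 * A * κ - 1 - 3 * A ^ 2 * κ ^ 2) * Complex.I_sq

theorem dConstEq_add (κ ζ : ℝ) (c c₁ c₂ : ℂ) (ζ₁ ζ₂ r : ℝ) :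
    dConstEq κ ζ c (c₁ + r * c₂) (ζ₁ + r * ζ₂)
      = dConstEq κ ζ c c₁ ζ₁ + r * dConstEq κ ζ c c₂ ζ₂ := by
  simp only [dConstEq, map_add, map_mul, Complex.conj_ofReal]
  push_cast
  ring

theorem dLinA_add (κ : ℝ) (c c₁ c₂ : ℂ) (ζ₁ ζ₂ r : ℝ) :
    dLinA κ c (c₁ + r * c₂) (ζ₁ + r * ζ₂) = dLinA κ c c₁ ζ₁ + r * dLinA κ c c₂ ζ₂ := by
  simp only [dLinA, map_add, map_mul, Complex.conj_ofReal]
  push_cast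
  ring

theorem dLinB_add (κ : ℝ) (c c₁ c₂ : ℂ) (r : ℝ) :
    dLinB κ c (c₁ + r * c₂) = dLinB κ c c₁ + r * dLinB κ c c₂ := by
  simp only [dLinB]
  ring

/-- In the direction c' = cp with p real, the derivative divided by c has imaginary part -(1 +
3κ|c|²)p, which never degenerates, and ζ' adjusts the real part freely. Folds of the curve are thus
covered. -/
theorem dConstEq_surjective {κ : ℝ} (hκ : 0 < κ) (ζ : ℝ) {c : ℂ} (hc : c ≠ 0) (y : ℂ) :
    ∃ (c' : ℂ) (ζ' : ℝ), dConstEq κ ζ c c' ζ' = y := by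
  have hcc : c * conj c = ((‖c‖ ^ 2 : ℝ) : ℂ) := by
    rw [Complex.mul_conj, Complex.normSq_eq_norm_sq]
  set A := ‖c‖ ^ 2
  have hA : (0 : ℝ) < 1 + 3 * κ * A := by positivity
  set p : ℝ := -(y / c).im / (1 + 3 * κ * A) with hp
  refine ⟨c * p, (y / c).re - p * (ζ - 3 * A), ?_⟩
  have h1 : y = c * ((y / c).re + (y / c).im * Complex.I) := by
    rw [Complex.re_add_im, mul_div_cancel₀ _ hc]
  have h2 : (p : ℂ) * (1 + 3 * κ * A) = -((y / c).im : ℂ) := by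
    have : p * (1 + 3 * κ * A) = -(y / c).im := div_mul_cancel₀ _ hA.ne'
    exact_mod_cast this
  conv_rhs => rw [h1]
  simp only [dConstEq, map_mul, Complex.conj_ofReal]
  push_cast
  linear_combination (-(1 + Complex.I * κ) * 3 * c * p) * hcc - c * Complex.I * h2

/-- The tangent of the curve of constant solutions, and the derivative along it of the
determinants. -/
theorem exists_tangent (κ ζ : ℝ) (c : ℂ) :
    ∃ (c' : ℂ) (ζ' : ℝ), dConstEq κ ζ c c' ζ' = 0 ∧
      ∀ (x σ : ℝ), x + ζ - 2 * ‖c‖ ^ 2 = σ * √(disc κ c) →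
      conj (x + linA κ ζ c) * dLinA κ c c' ζ' + (x + linA κ ζ c) * conj (dLinA κ c c' ζ')
        - conj (linB κ c) * dLinB κ c c' - linB κ c * conj (dLinB κ c c')
        = ((2 * transversality κ ζ c σ : ℝ) : ℂ) := by
  have hcc : c * conj c = ((‖c‖ ^ 2 : ℝ) : ℂ) := by
    rw [Complex.mul_conj, Complex.normSq_eq_norm_sq]
  have h4 : ‖c‖ ^ 4 = (‖c‖ ^ 2) ^ 2 := by ring
  simp only [transversality, h4]
  generalize ‖c‖ ^ 2 = A at hcc
  have hA : conj c * c = A := by rw [mul_comm, hcc]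
  -- With c' = cq, the imaginary part of the tangent equation fixes the direction of q and the real
  -- part then gives ζ'. The scale avoids denominators and produces the factor 2 in front of
  -- `transversality`.
  set q : ℂ := -((ζ - A : ℝ) + Complex.I * (1 + 3 * κ * A : ℝ)) with hq
  set ζ' : ℝ := (ζ - A) ^ 2 + (1 + κ * A) ^ 2 - 2 * A * (ζ - A) + 2 * κ * A * (1 + κ * A) with hζ'
  refine ⟨c * q, ζ', ?_, ?_⟩
  · have e : q * (ζ - Complex.I) + ζ' - (1 + Complex.I * κ) * (A * (2 * q + conj q)) = 0 := by
      rw [hq, hζ']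
      apply Complex.ext <;> simp [pow_two] <;> ring
    simp only [dConstEq, map_mul]
    linear_combination c * e - (1 + Complex.I * κ) * c * (2 * q + conj q) * hcc
  · intro x σ hx
    rw [← hx]
    have e1 : dLinA κ c (c * q) ζ' = ζ' - 2 * (1 + Complex.I * κ) * (A * (q + conj q)) := by
      simp only [dLinA, map_mul]
      linear_combination -2 * (1 + Complex.I * κ) * (q + conj q) * hcc
    have e2 : conj (linB κ c) * dLinB κ c (c * q) =
        2 * (1 - Complex.I * κ) * (1 + Complex.I * κ) * (A ^ 2 * q) := by
      simp only [linB, dLinB, map_mul, map_neg, map_add, map_pow, map_one, Complex.conj_ofReal,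
        Complex.conj_I]
      linear_combination
        2 * (1 - Complex.I * κ) * (1 + Complex.I * κ) * q * (c * conj c + A) * hcc
    have e3 : linB κ c * conj (dLinB κ c (c * q)) =
        2 * (1 - Complex.I * κ) * (1 + Complex.I * κ) * (A ^ 2 * conj q) := by
      simp only [linB, dLinB, map_mul, map_neg, map_add, map_one, map_ofNat,
        Complex.conj_ofReal, Complex.conj_I]
      linear_combination
        2 * (1 - Complex.I * κ) * (1 + Complex.I * κ) * conj q * (c * conj c + A) * hcc
    rw [e1, e2, e3, linA, hcc, hq, hζ']
    apply Complex.ext <;> simp [pow_two] <;> ring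

/-! ### Even functions -/

/-- The even functions in `L²(𝕋)`. -/
def evenL2 : Submodule ℂ L2 := ⨅ n : ℤ, LinearMap.ker (coeff (-n) - coeff n).toLinearMap

theorem mem_evenL2 {u : L2} : u ∈ evenL2 ↔ ∀ n, coeff (-n) u = coeff n u := by
  simp [evenL2, sub_eq_zero]

instance : CompleteSpace evenL2 := by
  have : IsClosed (evenL2 : Set L2) := by
    rw [evenL2, Submodule.coe_iInf]
    exact isClosed_iInter fun n => (coeff (-n) - coeff n).isClosed_ker
  exact this.completeSpace_coe

theorem toL2_mem_evenL2 {h : C(Torus, ℂ)} (hh : ∀ x, h (-x) = h x) : toL2 h ∈ evenL2 :=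
  mem_evenL2.2 fun n => by rw [coeff_toL2, coeff_toL2, fourierCoeff_neg_of_even hh]

/-- The constants as a bounded map into the continuous functions. -/
def constC : ℂ →L[ℝ] C(Torus, ℂ) := LinearMap.toContinuousLinearMap
  { toFun := fun c => ContinuousMap.const Torus c
    map_add' := fun _ _ => rfl
    map_smul' := fun _ _ => rfl }

theorem constC_apply (c : ℂ) : constC c = ContinuousMap.const Torus c := rfl

/-- The mean of a continuous function, as a constant function. -/
def meanC : C(Torus, ℂ) →L[ℝ] C(Torus, ℂ) := constC.comp (((coeff 0).comp toL2).restrictScalars ℝ)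

theorem meanC_apply (h : C(Torus, ℂ)) (x : Torus) : meanC h x = coeff 0 (toL2 h) := rfl

/-! ### The rescaled equation -/

/-- The terms of the equation at `c + s v` that are of second or third order in `v`, divided
by `s`. -/
def higherOrder (κ s : ℝ) (c : ℂ) (v : C(Torus, ℂ)) : C(Torus, ℂ) :=
  constC (1 + Complex.I * κ) * (constC s * (2 * constC c * (v * star v) + star (constC c) * v ^ 2)
    + constC s ^ 2 * (v ^ 2 * star v))

/-- The terms of the equation at `c + s v` without derivatives that are linear in `v`, divided
by `s`. -/
def linearOrder (κ ζ : ℝ) (c : ℂ) (v : C(Torus, ℂ)) : C(Torus, ℂ) :=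
  constC (ζ - Complex.I) * v
    - constC (1 + Complex.I * κ) * (2 * constC c * star (constC c) * v + constC c ^ 2 * star v)

/-- The equation at the constant `c`, as a constant function. -/
def zeroOrder (κ f ζ : ℝ) (c : ℂ) : C(Torus, ℂ) :=
  constC c * constC (ζ - Complex.I) - constC (1 + Complex.I * κ) * (constC c ^ 2 * star (constC c))
    + constC (Complex.I * f)

/-- The equation at `c + s v`, where `c` is the mean of `g` and `v = invLap g`. The mean of the
equation is left as it is and the mean-free part is divided by `s`. -/
def rescaled (d κ f s ζ : ℝ) (g : L2) : L2 :=
  d • (g - toL2 (constC (coeff 0 g)))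
    + toL2 (zeroOrder κ f ζ (coeff 0 g) + linearOrder κ ζ (coeff 0 g) (invLap g)
      - higherOrder κ s (coeff 0 g) (invLap g)
      + (1 - constC s) * meanC (higherOrder κ s (coeff 0 g) (invLap g)))

theorem two_apply (x : Torus) : (2 : C(Torus, ℂ)) x = 2 := rfl

theorem zeroOrder_apply (κ f ζ : ℝ) (c : ℂ) (x : Torus) :
    zeroOrder κ f ζ c x = constEq κ f ζ c := by
  have hcc : c * conj c = ((‖c‖ ^ 2 : ℝ) : ℂ) := by
    rw [Complex.mul_conj, Complex.normSq_eq_norm_sq]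
  simp only [zeroOrder, ContinuousMap.add_apply, ContinuousMap.sub_apply, ContinuousMap.mul_apply,
    ContinuousMap.pow_apply, ContinuousMap.star_apply, constC_apply, ContinuousMap.const_apply,
    constEq, RCLike.star_def]
  push_cast at hcc ⊢
  linear_combination -c * (1 + Complex.I * κ) * hcc

theorem linearOrder_apply (κ ζ : ℝ) (c : ℂ) (v : C(Torus, ℂ)) (x : Torus) :
    linearOrder κ ζ c v x = linA κ ζ c * v x + linB κ c * conj (v x) := by
  simp only [linearOrder, ContinuousMap.add_apply, ContinuousMap.sub_apply,
    ContinuousMap.mul_apply, ContinuousMap.pow_apply, ContinuousMap.star_apply, constC_apply,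
    ContinuousMap.const_apply, linA, linB, RCLike.star_def, two_apply]
  ring

theorem rescaled_mem_evenL2 (d κ f s ζ : ℝ) {g : L2} (hg : g ∈ evenL2) :
    rescaled d κ f s ζ g ∈ evenL2 := by
  have hv := invLap_neg (mem_evenL2.1 hg)
  have hc : ∀ c, toL2 (constC c) ∈ evenL2 := fun c => toL2_mem_evenL2 fun x => rfl
  refine evenL2.add_mem ?_ (toL2_mem_evenL2 fun x => ?_)
  · exact (evenL2.restrictScalars ℝ).smul_mem d (evenL2.sub_mem hg (hc _))
  · simp only [zeroOrder, linearOrder, higherOrder, ContinuousMap.add_apply,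
      ContinuousMap.sub_apply, ContinuousMap.mul_apply, ContinuousMap.pow_apply,
      ContinuousMap.star_apply, hv, meanC_apply, constC_apply, ContinuousMap.const_apply,
      two_apply, ContinuousMap.one_apply]

theorem coeff_toL2_star (h : C(Torus, ℂ)) (n : ℤ) :
    coeff n (toL2 (star h)) = conj (coeff (-n) (toL2 h)) := by
  rw [coeff_toL2, coeff_toL2]
  exact fourierCoeff_conj h n

theorem constC_mul (c : ℂ) (h : C(Torus, ℂ)) : constC c * h = c • h := by
  ext x; simp [constC_apply]

theorem coeff_linearOrder (κ ζ : ℝ) (c : ℂ) (v : C(Torus, ℂ)) (n : ℤ) :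
    coeff n (toL2 (linearOrder κ ζ c v))
      = linA κ ζ c * coeff n (toL2 v) + linB κ c * conj (coeff (-n) (toL2 v)) := by
  have : linearOrder κ ζ c v = linA κ ζ c • v + linB κ c • star v := by
    ext x
    rw [linearOrder_apply]
    simp
  rw [this, map_add, map_add, map_smul, map_smul, map_smul, map_smul, coeff_toL2_star,
    smul_eq_mul, smul_eq_mul]

theorem zeroOrder_eq (κ f ζ : ℝ) (c : ℂ) : zeroOrder κ f ζ c = constC (constEq κ f ζ c) := by
  ext x
  exact zeroOrder_apply κ f ζ c x

theorem coeff_toL2_constC (n : ℤ) (c : ℂ) : coeff n (toL2 (constC c)) = if n = 0 then c else 0 :=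
  coeff_toL2_const n c

theorem meanC_eq (h : C(Torus, ℂ)) : meanC h = constC (coeff 0 (toL2 h)) := rfl

/-- For `s ≠ 0` the zeros of the rescaled equation are solutions. -/
theorem isSolution_of_rescaled {d κ f s ζ : ℝ} {g : L2} (hg : rescaled d κ f s ζ g = 0)
    {S : L2 →L[ℝ] H2} (hS : ∀ g, H2.fn (S g) = toL2 (invLap g) ∧
      H2.deriv2 (S g) = toL2 (ContinuousMap.const Torus (coeff 0 g)) - g) :
    IsSolution d κ f ζ (constL (coeff 0 g) + s • S g) := by
  set c := coeff 0 g with hc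
  set v := invLap g with hv
  set N := higherOrder κ s c v with hN
  -- The mean of `linearOrder` vanishes because v is mean-free, and the `meanC` correction turns the
  -- mean of N into s times it.
  have hmean : constEq κ f ζ c = s * coeff 0 (toL2 N) := by
    have h0 := congrArg (coeff 0) hg
    rw [rescaled, ← hc, ← hv, ← hN, map_add, coeff_smul_real, map_sub, coeff_toL2_constC,
      if_pos rfl, map_add, map_sub, map_add, map_add, map_sub, map_add, coeff_linearOrder,
      zeroOrder_eq, coeff_toL2_constC, sub_mul, one_mul, map_sub, map_sub, meanC_eq,
      constC_mul, map_smul, map_smul, coeff_toL2_constC, neg_zero, hv, coeff_invLap, map_zero] at h0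
    simp only [if_true, Int.cast_zero, ne_eq, OfNat.ofNat_ne_zero, not_false_eq_true, zero_pow,
      div_zero, map_zero, mul_zero, add_zero, smul_eq_mul, ← hc] at h0
    linear_combination h0
  set h : C(Torus, ℂ) := constC c + s • v with hh
  have hfn : H2.fn (constL c + s • S g) = toL2 h := by
    rw [← fnL_apply, map_add, map_smul, fnL_apply, fnL_apply, (hS g).1, constL_apply, fn_const,
      hh, map_add, constC_apply, map_real_smul toL2 toL2.continuous]
  have hd2 : H2.deriv2 (constL c + s • S g) = s • (toL2 (constC c) - g) := by
    rw [← deriv2L_apply, map_add, map_smul, deriv2L_apply, deriv2L_apply, (hS g).2, constL_apply,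
      deriv2_const, zero_add, constC_apply]
  set P : C(Torus, ℂ) := h * constC (ζ - Complex.I) - constC (1 + Complex.I * κ) * (h ^ 2 * star h)
    + constC (Complex.I * f) with hP
  have hPeq : P = zeroOrder κ f ζ c + constC s * linearOrder κ ζ c v - constC s * N := by
    rw [hP, hN, zeroOrder, linearOrder, higherOrder, hh]
    have e1 : s • v = constC s * v := by rw [constC_mul]; ext x; simp
    have e2 : star (constC (s : ℂ)) = constC s := by ext x; simp [constC_apply]
    rw [e1, star_add, star_mul, e2]
    ring
  -- Multiplying the rescaled equation by s restores the mean-free part of the original one; the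
  -- mean is supplied by `hmean`.
  have hL2 : (-d) • (s • (toL2 (constC c) - g)) + toL2 P = 0 := by
    have h1 : s • rescaled d κ f s ζ g = 0 := by rw [hg, smul_zero]
    refine ext_coeff fun n => ?_
    have h2 := congrArg (coeff n) h1
    rw [rescaled, ← hc, ← hv, ← hN] at h2
    rw [hPeq]
    simp only [map_add, map_sub, coeff_smul_real, constC_mul, map_smul, zeroOrder_eq, sub_mul,
      one_mul, meanC_eq, coeff_toL2_constC, hmean, map_zero, smul_eq_mul] at h2 ⊢
    split_ifs at h2 ⊢ with hn
    · push_cast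
      linear_combination h2
    · push_cast
      linear_combination h2
  have h0 : ∀ᵐ x ∂torusMeasure, ((-d) • (s • (toL2 (constC c) - g)) + toL2 P : L2) x = 0 := by
    rw [hL2]
    exact Lp.coeFn_zero ℂ 2 torusMeasure
  rw [← hd2] at h0
  filter_upwards [h0, Lp.coeFn_add ((-d) • H2.deriv2 (constL c + s • S g)) (toL2 P),
    Lp.coeFn_smul (-d) (H2.deriv2 (constL c + s • S g)),
    ContinuousMap.coeFn_toLp (p := 2) (𝕜 := ℂ) torusMeasure P,
    ContinuousMap.coeFn_toLp (p := 2) (𝕜 := ℂ) torusMeasure h] with x h0 h1 h2 h3 h4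
  rw [h1, Pi.add_apply, h2, Pi.smul_apply, h3] at h0
  rw [hfn, h4]
  have hcc : h x * conj (h x) = ((‖h x‖ ^ 2 : ℝ) : ℂ) := by
    rw [Complex.mul_conj, Complex.normSq_eq_norm_sq]
  simp only [hP, ContinuousMap.add_apply, ContinuousMap.sub_apply, ContinuousMap.mul_apply,
    ContinuousMap.pow_apply, ContinuousMap.star_apply, constC_apply, ContinuousMap.const_apply,
    RCLike.star_def, Complex.real_smul] at h0
  push_cast at h0
  rw [← hcc]
  linear_combination h0

/-! ### The rescaled equation as a smooth map on even functions -/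

/-- The rescaled equation as a map on even functions. -/
def rescaledMap (d κ f : ℝ) (x : ℝ × ℝ × evenL2) : evenL2 :=
  ⟨rescaled d κ f x.1 x.2.1 x.2.2, rescaled_mem_evenL2 d κ f x.1 x.2.1 x.2.2.2⟩

/-- Everything is a polynomial in bounded real-linear maps into the Banach algebra C(𝕋). Conjugation
is only real-linear, hence smoothness over ℝ. -/
theorem contDiff_rescaledMap (d κ f : ℝ) : ContDiff ℝ ∞ (rescaledMap d κ f) := by
  have hg : ContDiff ℝ ∞ fun x : ℝ × ℝ × evenL2 => (x.2.2 : L2) :=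
    ((evenL2.subtypeL.restrictScalars ℝ).comp
      ((ContinuousLinearMap.snd ℝ ℝ evenL2).comp
        (ContinuousLinearMap.snd ℝ ℝ (ℝ × evenL2)))).contDiff
  have hstar : ContDiff ℝ ∞ (star : C(Torus, ℂ) → C(Torus, ℂ)) :=
    (starL' ℝ : C(Torus, ℂ) ≃L[ℝ] C(Torus, ℂ)).contDiff
  have hc : ContDiff ℝ ∞ fun x : ℝ × ℝ × evenL2 => constC (coeff 0 (x.2.2 : L2)) :=
    (constC.comp ((coeff 0).restrictScalars ℝ)).contDiff.comp hg
  have hv : ContDiff ℝ ∞ fun x : ℝ × ℝ × evenL2 => invLap (x.2.2 : L2) :=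
    (invLap.restrictScalars ℝ).contDiff.comp hg
  have hs : ContDiff ℝ ∞ fun x : ℝ × ℝ × evenL2 => constC (x.1 : ℂ) :=
    (constC.comp Complex.ofRealCLM).contDiff.comp contDiff_fst
  have hζ : ContDiff ℝ ∞ fun x : ℝ × ℝ × evenL2 => constC (x.2.1 - Complex.I) :=
    constC.contDiff.comp ((Complex.ofRealCLM.contDiff.comp
      (contDiff_fst.comp contDiff_snd)).sub contDiff_const)
  have hc' := hstar.comp hc
  have hv' := hstar.comp hv
  have hN : ContDiff ℝ ∞ fun x : ℝ × ℝ × evenL2 =>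
      higherOrder κ x.1 (coeff 0 (x.2.2 : L2)) (invLap (x.2.2 : L2)) :=
    contDiff_const.mul ((hs.mul (((contDiff_const.mul hc).mul (hv.mul hv')).add
      (hc'.mul (hv.pow 2)))).add ((hs.pow 2).mul ((hv.pow 2).mul hv')))
  have hL : ContDiff ℝ ∞ fun x : ℝ × ℝ × evenL2 =>
      linearOrder κ x.2.1 (coeff 0 (x.2.2 : L2)) (invLap (x.2.2 : L2)) :=
    (hζ.mul hv).sub (contDiff_const.mul ((((contDiff_const.mul hc).mul hc').mul hv).add
      ((hc.pow 2).mul hv')))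
  have hZ : ContDiff ℝ ∞ fun x : ℝ × ℝ × evenL2 =>
      zeroOrder κ f x.2.1 (coeff 0 (x.2.2 : L2)) :=
    ((hc.mul hζ).sub (contDiff_const.mul ((hc.pow 2).mul hc'))).add contDiff_const
  have hR : ContDiff ℝ ∞ fun x : ℝ × ℝ × evenL2 => rescaled d κ f x.1 x.2.1 x.2.2 :=
    ((hg.sub ((toL2.restrictScalars ℝ).contDiff.comp hc)).const_smul d).add
      ((toL2.restrictScalars ℝ).contDiff.comp
        (((hZ.add hL).sub hN).add ((contDiff_const.sub hs).mul (meanC.contDiff.comp hN))))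
  -- Smoothness into the ambient L² passes to the subspace by composing with the orthogonal
  -- projection, which acts here as the identity.
  have hproj : rescaledMap d κ f = fun x => evenL2.orthogonalProjectionOnto
      (rescaled d κ f x.1 x.2.1 x.2.2) := by
    funext x
    exact (Submodule.orthogonalProjectionOnto_mem_subspace_eq_self (rescaledMap d κ f x)).symm
  rw [hproj]
  exact (evenL2.orthogonalProjectionOnto.restrictScalars ℝ).contDiff.comp hR

theorem higherOrder_zero (κ : ℝ) (c : ℂ) (v : C(Torus, ℂ)) : higherOrder κ 0 c v = 0 := by
  have : constC ((0 : ℝ) : ℂ) = 0 := by rw [Complex.ofReal_zero, map_zero]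
  rw [higherOrder, this]
  ring

theorem coeff_rescaled_zero (d κ f ζ : ℝ) {g : L2} (hg : g ∈ evenL2) (n : ℤ) :
    coeff n (rescaled d κ f 0 ζ g) = if n = 0 then constEq κ f ζ (coeff 0 g) else
      (d * (n : ℂ) ^ 2 + linA κ ζ (coeff 0 g)) * (coeff n g / (n : ℂ) ^ 2)
        + linB κ (coeff 0 g) * conj (coeff n g / (n : ℂ) ^ 2) := by
  rw [rescaled, higherOrder_zero, map_zero, mul_zero, sub_zero, add_zero, map_add, coeff_smul_real,
    map_sub, map_add, map_add, coeff_linearOrder, zeroOrder_eq, coeff_toL2_constC,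
    coeff_toL2_constC, coeff_invLap, coeff_invLap, mem_evenL2.1 hg]
  split_ifs with hn
  · subst hn
    simp
  · have : (n : ℂ) ≠ 0 := by exact_mod_cast hn
    push_cast
    rw [neg_sq]
    field_simp
    ring

open Filter Topology

/-! ### Bifurcation -/

theorem coeff_add_real_smul (n : ℤ) (t : ℝ) (u v : L2) :
    coeff n (u + t • v) = coeff n u + t * coeff n v := by
  rw [map_add, coeff_smul_real]

theorem hasDerivAt_line (p q : ℂ) : HasDerivAt (fun t : ℝ => p + t * q) q 0 := by
  simpa using (Complex.ofRealCLM.hasDerivAt (x := (0 : ℝ))).mul_const q |>.const_add p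

theorem hasDerivAt_conj_line (p q : ℂ) :
    HasDerivAt (fun t : ℝ => conj (p + t * q)) (conj q) 0 := by
  simpa using hasDerivAt_line (conj p) (conj q)

theorem hasDerivAt_linA (κ ζ ζ' : ℝ) (c c' : ℂ) :
    HasDerivAt (fun t : ℝ => linA κ (ζ + t * ζ') (c + t * c')) (dLinA κ c c' ζ') 0 := by
  have h1 : HasDerivAt (fun t : ℝ => ((ζ + t * ζ' : ℝ) : ℂ)) ζ' 0 := by
    simpa using hasDerivAt_line ζ ζ'
  have h2 := (hasDerivAt_line c c').mul (hasDerivAt_conj_line c c')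
  refine ((h1.sub_const Complex.I).sub (h2.const_mul (2 * (1 + Complex.I * κ)))).congr_deriv ?_
  simp [dLinA]

theorem hasDerivAt_linB (κ : ℝ) (c c' : ℂ) :
    HasDerivAt (fun t : ℝ => linB κ (c + t * c')) (dLinB κ c c') 0 := by
  refine (((hasDerivAt_line c c').pow 2).const_mul (1 + Complex.I * (κ : ℂ))).neg.congr_deriv ?_
  simp [dLinB]
  ring

theorem constEq_eq (κ f ζ : ℝ) (c : ℂ) : constEq κ f ζ c =
    c * (ζ - Complex.I) - (1 + Complex.I * κ) * (c ^ 2 * conj c) + Complex.I * f := by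
  have hcc : c * conj c = ((‖c‖ ^ 2 : ℝ) : ℂ) := by
    rw [Complex.mul_conj, Complex.normSq_eq_norm_sq]
  rw [constEq]
  push_cast at hcc ⊢
  linear_combination c * (1 + Complex.I * κ) * hcc

theorem hasDerivAt_constEq (κ f ζ ζ' : ℝ) (c c' : ℂ) :
    HasDerivAt (fun t : ℝ => constEq κ f (ζ + t * ζ') (c + t * c')) (dConstEq κ ζ c c' ζ') 0 := by
  simp only [constEq_eq]
  have h1 : HasDerivAt (fun t : ℝ => ((ζ + t * ζ' : ℝ) : ℂ)) ζ' 0 := by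
    simpa using hasDerivAt_line ζ ζ'
  have h2 := (((hasDerivAt_line c c').pow 2).mul (hasDerivAt_conj_line c c')).const_mul
    (1 + Complex.I * (κ : ℂ))
  refine ((((hasDerivAt_line c c').mul (h1.sub_const Complex.I)).sub h2).add_const
    (Complex.I * (f : ℂ))).congr_deriv ?_
  simp [dConstEq, -mul_eq_mul_left_iff]
  ring

/-- The derivative of the rescaled equation at `s = 0` in Fourier coefficients. -/
theorem coeff_fderiv_rescaledMap (d κ f ζ ζ' : ℝ) (g g' : evenL2) (n : ℤ) :
    coeff n (fderiv ℝ (rescaledMap d κ f) (0, ζ, g) (0, ζ', g') : L2) = if n = 0 then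
      dConstEq κ ζ (coeff 0 (g : L2)) (coeff 0 (g' : L2)) ζ' else
      (d * (n : ℂ) ^ 2 + linA κ ζ (coeff 0 (g : L2))) * (coeff n (g' : L2) / (n : ℂ) ^ 2)
        + linB κ (coeff 0 (g : L2)) * conj (coeff n (g' : L2) / (n : ℂ) ^ 2)
        + (dLinA κ (coeff 0 (g : L2)) (coeff 0 (g' : L2)) ζ' * (coeff n (g : L2) / (n : ℂ) ^ 2)
        + dLinB κ (coeff 0 (g : L2)) (coeff 0 (g' : L2)) * conj (coeff n (g : L2) / (n : ℂ) ^ 2)) := by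
  -- The derivative is computed along a line with s fixed at 0, where the cubic remainder vanishes
  -- and each coefficient is explicit.
  have hline : HasDerivAt (fun t : ℝ => ((0, ζ, g) : ℝ × ℝ × evenL2) + t • (0, ζ', g'))
      (0, ζ', g') 0 := by
    simpa using (hasDerivAt_id (0 : ℝ)).smul_const ((0, ζ', g') : ℝ × ℝ × evenL2)
      |>.const_add ((0, ζ, g) : ℝ × ℝ × evenL2)
  have hF : HasFDerivAt (rescaledMap d κ f) (fderiv ℝ (rescaledMap d κ f) (0, ζ, g))
      (((0, ζ, g) : ℝ × ℝ × evenL2) + (0 : ℝ) • (0, ζ', g')) := by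
    rw [zero_smul, add_zero]
    exact ((contDiff_rescaledMap d κ f).differentiable (by simp) _).hasFDerivAt
  have h1 := (((coeff n).comp evenL2.subtypeL).restrictScalars ℝ).hasFDerivAt.comp_hasDerivAt
    (0 : ℝ) (hF.comp_hasDerivAt (0 : ℝ) hline)
  refine h1.unique ?_
  have e : ∀ t : ℝ, (rescaledMap d κ f (((0, ζ, g) : ℝ × ℝ × evenL2) + t • (0, ζ', g')) : L2)
      = rescaled d κ f 0 (ζ + t * ζ') ((g : L2) + t • (g' : L2)) := by
    intro t
    simp [rescaledMap]
  have hmem : ∀ t : ℝ, (g : L2) + t • (g' : L2) ∈ evenL2 := fun t =>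
    evenL2.add_mem g.2 ((evenL2.restrictScalars ℝ).smul_mem t g'.2)
  have e2 : ((((coeff n).comp evenL2.subtypeL).restrictScalars ℝ) ∘ (rescaledMap d κ f) ∘
      fun t : ℝ => ((0, ζ, g) : ℝ × ℝ × evenL2) + t • (0, ζ', g'))
      = fun t : ℝ => if n = 0 then constEq κ f (ζ + t * ζ') (coeff 0 (g : L2) + t * coeff 0 (g' : L2))
        else (d * (n : ℂ) ^ 2 + linA κ (ζ + t * ζ') (coeff 0 (g : L2) + t * coeff 0 (g' : L2)))
          * (coeff n (g : L2) / (n : ℂ) ^ 2 + t * (coeff n (g' : L2) / (n : ℂ) ^ 2))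
        + linB κ (coeff 0 (g : L2) + t * coeff 0 (g' : L2))
          * conj (coeff n (g : L2) / (n : ℂ) ^ 2 + t * (coeff n (g' : L2) / (n : ℂ) ^ 2)) := by
    funext t
    change coeff n (rescaledMap d κ f (((0, ζ, g) : ℝ × ℝ × evenL2) + t • (0, ζ', g')) : L2) = _
    rw [e, coeff_rescaled_zero d κ f _ (hmem t), coeff_add_real_smul, coeff_add_real_smul, add_div,
      mul_div_assoc]
  rw [e2]
  by_cases hn : n = 0
  · simp only [if_pos hn]
    exact hasDerivAt_constEq κ f ζ ζ' _ _
  · simp only [if_neg hn]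
    refine ((((hasDerivAt_linA κ ζ ζ' _ _).const_add _).mul (hasDerivAt_line _ _)).add
      ((hasDerivAt_linB κ _ _).mul (hasDerivAt_conj_line _ _))).congr_deriv ?_
    simp
    ring

/-- The cosine `exp(ikx) + exp(-ikx)` with coefficient `z`. -/
def cosL2 (k : ℕ) (z : ℂ) : L2 := z • (toL2 (fourier (k : ℤ)) + toL2 (fourier (-(k : ℤ))))

theorem coeff_cosL2 {k : ℕ} (hk : 1 ≤ k) (z : ℂ) (n : ℤ) :
    coeff n (cosL2 k z) = if |n| = k then z else 0 := by
  rw [cosL2, map_smul, map_add, coeff_fourier, coeff_fourier, smul_eq_mul]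
  have : |n| = k ↔ n = k ∨ n = -k := abs_eq (by positivity)
  by_cases h1 : n = k
  · have h2 : n ≠ -k := by omega
    rw [if_pos h1, if_neg h2, if_pos (this.2 (Or.inl h1)), add_zero, mul_one]
  · by_cases h2 : n = -k
    · rw [if_neg h1, if_pos h2, if_pos (this.2 (Or.inr h2)), zero_add, mul_one]
    · rw [if_neg h1, if_neg h2, if_neg (by rw [this]; tauto), add_zero, mul_zero]

theorem coeff_toL2_constC_add_cosL2 {k : ℕ} (hk : 1 ≤ k) (c z : ℂ) (n : ℤ) :
    coeff n (toL2 (constC c) + cosL2 k z) = if n = 0 then c else if |n| = k then z else 0 := by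
  rw [map_add, coeff_toL2_constC, coeff_cosL2 hk]
  by_cases hn : n = 0
  · subst hn
    have : ¬ |(0 : ℤ)| = k := by simp; omega
    simp only [if_true, this, if_false, add_zero]
  · simp [hn]

theorem constC_add_cosL2_mem {k : ℕ} (hk : 1 ≤ k) (c z : ℂ) :
    toL2 (constC c) + cosL2 k z ∈ evenL2 :=
  mem_evenL2.2 fun n => by
    rw [coeff_toL2_constC_add_cosL2 hk, coeff_toL2_constC_add_cosL2 hk, abs_neg]
    simp only [neg_eq_zero]

/-- The unknown g has mean near a₀ and k-th coefficient near k²φ with φ in the kernel of mode k; s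
is the amplitude of the mean-free part. Only local surjectivity of the rescaled equation is needed.
-/
theorem isBifurcationPoint_of_transversality {d κ f ζ : ℝ} (hd : d ≠ 0) (hκ : 0 < κ) (hf : f ≠ 0)
    {a₀ : ℂ} (ha : constEq κ f ζ a₀ = 0) (hD : 0 ≤ disc κ a₀) {σ : ℝ} (hσ : σ = 1 ∨ σ = -1)
    (hk : IsPosNat (kNumber d κ ζ a₀ σ))
    (hk' : IsPosNat (kNumber d κ ζ a₀ (-σ)) → kNumber d κ ζ a₀ (-σ) = kNumber d κ ζ a₀ σ)
    (ht : transversality κ ζ a₀ σ ≠ 0) : IsBifurcationPoint d κ f (H2.const a₀, ζ) := by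
  obtain ⟨k, hk1, hkn⟩ := hk
  have ha0 : a₀ ≠ 0 := ne_zero_of_constEq hf ha
  have hsq : √(disc κ a₀) ^ 2 = disc κ a₀ := Real.sq_sqrt hD
  have hσ2 : σ ^ 2 = 1 := by rcases hσ with rfl | rfl <;> norm_num
  have hk0 : (0 : ℝ) < k := by exact_mod_cast hk1
  have hkX : d * (k : ℝ) ^ 2 + ζ - 2 * ‖a₀‖ ^ 2 = σ * √(disc κ a₀) := by
    have h1 : 0 < (2 * ‖a₀‖ ^ 2 - ζ + σ * √(disc κ a₀)) / d := by
      refine Real.sqrt_pos.1 ?_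
      rw [← kNumber, hkn]
      exact hk0
    rw [← hkn, kNumber, Real.sq_sqrt h1.le]
    field_simp
    ring
  -- A vanishing determinant means dn² is one of the two roots: the root with sign σ gives |n| = k,
  -- and the other makes |n| the second k-number, which `hk'` identifies with k.
  have hother : ∀ n : ℤ, n ≠ 0 → |n| ≠ k →
      (d * (n : ℝ) ^ 2 + ζ - 2 * ‖a₀‖ ^ 2) ^ 2 - disc κ a₀ ≠ 0 := by
    intro n hn hnk h0
    have h1 : (d * (n : ℝ) ^ 2 + ζ - 2 * ‖a₀‖ ^ 2) ^ 2 = (σ * √(disc κ a₀)) ^ 2 := by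
      rw [mul_pow, hσ2, hsq]
      linarith
    have habs : (n : ℝ) ^ 2 = (n.natAbs : ℝ) ^ 2 := by
      rw [Nat.cast_natAbs, Int.cast_abs, sq_abs]
    have hne : n.natAbs ≠ k := fun h => hnk (by rw [← h, Int.natCast_natAbs])
    rcases sq_eq_sq_iff_eq_or_eq_neg.1 h1 with h2 | h2
    · have h3 : (n.natAbs : ℝ) ^ 2 = (k : ℝ) ^ 2 := by
        rw [← habs]
        apply mul_left_cancel₀ hd
        linarith
      apply hne
      exact_mod_cast (pow_left_inj₀ (Nat.cast_nonneg _) (Nat.cast_nonneg _) two_ne_zero).1 h3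
    · have h3 : kNumber d κ ζ a₀ (-σ) = n.natAbs := by
        rw [kNumber, show (2 * ‖a₀‖ ^ 2 - ζ + -σ * √(disc κ a₀)) / d = (n.natAbs : ℝ) ^ 2 by
          rw [← habs, div_eq_iff hd]; linarith, Real.sqrt_sq (Nat.cast_nonneg _)]
      have h4 := hk' ⟨n.natAbs, Int.one_le_abs hn |> fun h => by omega, h3⟩
      rw [h3, hkn] at h4
      exact hne (by exact_mod_cast h4)
  set αk : ℂ := d * (k : ℂ) ^ 2 + linA κ ζ a₀ with hαk
  set β : ℂ := linB κ a₀ with hβ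
  have hαβ : αk * conj αk = β * conj β := by
    have := det_eq κ ζ (d * (k : ℝ) ^ 2) a₀
    rw [hkX, mul_pow, hσ2, hsq, one_mul, sub_self, Complex.ofReal_zero, sub_eq_zero] at this
    push_cast at this
    exact this
  have hβ0 : β ≠ 0 := by
    have : (1 : ℂ) + Complex.I * κ ≠ 0 := fun h => by simpa using congrArg Complex.re h
    exact neg_ne_zero.2 (mul_ne_zero this (pow_ne_zero 2 ha0))
  have hα0 : αk ≠ 0 := by
    intro h
    rw [h, zero_mul] at hαβ
    exact mul_ne_zero hβ0 ((map_ne_zero _).2 hβ0) hαβ.symm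
  obtain ⟨φ, hφ, hker⟩ := exists_kernel hα0 hαβ
  obtain ⟨τ, τζ, hτ, hdet⟩ := exists_tangent κ ζ a₀
  have hdetk := hdet (d * (k : ℝ) ^ 2) σ hkX
  push_cast at hdetk
  have hdecomp := exists_decomposition (α' := dLinA κ a₀ τ τζ) (β' := dLinB κ a₀ τ)
    hα0 hαβ hφ hker (δ := 2 * transversality κ ζ a₀ σ) (by positivity)
    (by push_cast; exact hdetk)
  have hkC : (k : ℂ) ≠ 0 := by exact_mod_cast hk0.ne'
  have habs : ∀ n : ℤ, |n| = k → (n : ℂ) ^ 2 = (k : ℂ) ^ 2 := by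
    intro n hn
    have : n ^ 2 = (k : ℤ) ^ 2 := by rw [← hn, sq_abs]
    exact_mod_cast this
  let g₀ : evenL2 := ⟨_, constC_add_cosL2_mem hk1 a₀ ((k : ℂ) ^ 2 * φ)⟩
  have hg₀ : ∀ n, coeff n (g₀ : L2)
      = if n = 0 then a₀ else if |n| = k then (k : ℂ) ^ 2 * φ else 0 :=
    coeff_toL2_constC_add_cosL2 hk1 _ _
  have hg₀0 : coeff 0 (g₀ : L2) = a₀ := by rw [hg₀, if_pos rfl]
  let Φ := rescaledMap d κ f
  have hbase : Φ (0, ζ, g₀) = 0 := by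
    apply Subtype.ext
    refine ext_coeff fun n => ?_
    change coeff n (rescaled d κ f 0 ζ g₀) = coeff n 0
    rw [coeff_rescaled_zero d κ f ζ g₀.2, hg₀0, map_zero, hg₀]
    split_ifs with h1 h2
    · exact ha
    · rw [habs n h2, mul_div_cancel_left₀ _ (pow_ne_zero 2 hkC)]
      exact hker
    · simp
  let A := fderiv ℝ Φ (0, ζ, g₀)
  have hstrict : HasStrictFDerivAt Φ A (0, ζ, g₀) :=
    (contDiff_rescaledMap d κ f).contDiffAt.hasStrictFDerivAt (by simp)
  -- Mode 0 is solved by (c₁, ζ₁). Adding r times the tangent (τ, τζ) does not disturb it, and r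
  -- together with z solves mode k. The other modes are inverted individually in `b`, whose symbol
  -- depends on n only through n² and |n|, so evenness is kept.
  have hsurj : ∀ y : evenL2, ∃ (ζ' : ℝ) (g' : evenL2), A (0, ζ', g') = y := by
    intro y
    obtain ⟨c₁, ζ₁, h₁⟩ := dConstEq_surjective hκ ζ ha0 (coeff 0 (y : L2))
    obtain ⟨r, z, hz⟩ := hdecomp (coeff k (y : L2) - (dLinA κ a₀ c₁ ζ₁ * φ + dLinB κ a₀ c₁ * conj φ))
    obtain ⟨C, hC⟩ := exists_bound_modes hd (linA κ ζ a₀) β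
    let b : ℤ → ℂ := fun n => if n = 0 ∨ |n| = k then 0 else
      (n : ℂ) ^ 2 * ((conj (d * (n : ℂ) ^ 2 + linA κ ζ a₀) * coeff n (y : L2)
        - β * conj (coeff n (y : L2))) /
        ((d * (n : ℂ) ^ 2 + linA κ ζ a₀) * conj (d * (n : ℂ) ^ 2 + linA κ ζ a₀) - β * conj β))
    obtain ⟨w, hw, -⟩ := exists_coeff_eq (y : L2) b (max C 0) (fun n => by
      simp only [b]
      split_ifs
      · rw [norm_zero]; positivity
      · exact (hC n _).trans (by gcongr; exact le_max_left _ _))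
    have hweven : w ∈ evenL2 := mem_evenL2.2 fun n => by
      rw [hw, hw]
      simp only [b, neg_eq_zero, abs_neg, Int.cast_neg, neg_sq, mem_evenL2.1 y.2 n]
    let g' : evenL2 := ⟨_, evenL2.add_mem
      (constC_add_cosL2_mem hk1 (c₁ + r * τ) ((k : ℂ) ^ 2 * z)) hweven⟩
    have hg' : ∀ n, coeff n (g' : L2) = (if n = 0 then c₁ + r * τ else
        if |n| = k then (k : ℂ) ^ 2 * z else 0) + b n := by
      intro n
      change coeff n (_ + w) = _
      rw [map_add, coeff_toL2_constC_add_cosL2 hk1, hw]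
    have hg'0 : coeff 0 (g' : L2) = c₁ + r * τ := by
      rw [hg', if_pos rfl]
      simp [b]
    refine ⟨ζ₁ + r * τζ, g', Subtype.ext (ext_coeff fun n => ?_)⟩
    change coeff n (fderiv ℝ (rescaledMap d κ f) (0, ζ, g₀) (0, ζ₁ + r * τζ, g') : L2) = _
    rw [coeff_fderiv_rescaledMap, hg₀0, hg'0]
    split_ifs with hn
    · rw [dConstEq_add, hτ, h₁, hn, mul_zero, add_zero]
    · by_cases hnk : |n| = k
      · have hbn : b n = 0 := by simp only [b, hnk, or_true, if_true]
        have hyn : coeff n (y : L2) = coeff k (y : L2) := by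
          rcases (abs_eq (by positivity)).1 hnk with h | h
          · rw [h]
          · rw [h, mem_evenL2.1 y.2]
        rw [hg', hg₀, if_neg hn, if_pos hnk, hbn, add_zero, if_neg hn, if_pos hnk, habs n hnk,
          mul_div_cancel_left₀ _ (pow_ne_zero 2 hkC), mul_div_cancel_left₀ _ (pow_ne_zero 2 hkC),
          dLinA_add, dLinB_add, hyn]
        linear_combination hz
      · have hbn : b n = (n : ℂ) ^ 2 * ((conj (d * (n : ℂ) ^ 2 + linA κ ζ a₀) * coeff n (y : L2)
          - β * conj (coeff n (y : L2))) /
          ((d * (n : ℂ) ^ 2 + linA κ ζ a₀) * conj (d * (n : ℂ) ^ 2 + linA κ ζ a₀)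
            - β * conj β)) := by
          simp only [b, hn, hnk, or_self, if_false]
        have hnC : (n : ℂ) ≠ 0 := by exact_mod_cast hn
        have hdetn : (d * (n : ℂ) ^ 2 + linA κ ζ a₀) * conj (d * (n : ℂ) ^ 2 + linA κ ζ a₀)
            - β * conj β ≠ 0 := by
          have h1 := det_eq κ ζ (d * (n : ℝ) ^ 2) a₀
          have h2 : ((((d * (n : ℝ) ^ 2 + ζ - 2 * ‖a₀‖ ^ 2) ^ 2 - disc κ a₀ : ℝ)) : ℂ) ≠ 0 := by
            exact_mod_cast hother n hn hnk
          rw [← h1] at h2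
          push_cast at h2
          exact h2
        rw [hg', hg₀, if_neg hn, if_neg hnk, zero_add, if_neg hn, if_neg hnk, hbn,
          mul_div_cancel_left₀ _ (pow_ne_zero 2 hnC), solve_mode hdetn]
        simp
  -- Recording s as a component allows zeros of Φ to be found with a prescribed s ≠ 0.
  let Ψ : ℝ × ℝ × evenL2 → ℝ × evenL2 := fun x => (x.1, Φ x)
  have hΨ : HasStrictFDerivAt Ψ ((ContinuousLinearMap.fst ℝ ℝ (ℝ × evenL2)).prod A) (0, ζ, g₀) :=
    hasStrictFDerivAt_fst.prodMk hstrict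
  have hrange : ((ContinuousLinearMap.fst ℝ ℝ (ℝ × evenL2)).prod A).range = ⊤ := by
    rw [LinearMap.range_eq_top]
    rintro ⟨s, y⟩
    obtain ⟨ζ', g', h⟩ := hsurj (y - A (s, 0, 0))
    refine ⟨(s, ζ', g'), Prod.ext rfl ?_⟩
    change A (s, ζ', g') = y
    have : ((s, ζ', g') : ℝ × ℝ × evenL2) = (s, 0, 0) + (0, ζ', g') := by simp
    rw [this, map_add, h, add_sub_cancel]
  have hmap := hΨ.map_nhds_eq_of_surj hrange
  have hΨ0 : Ψ (0, ζ, g₀) = (0, 0) := Prod.ext rfl hbase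
  rw [hΨ0] at hmap
  obtain ⟨S, hS⟩ := exists_lift
  let E : ℝ × ℝ × evenL2 → H2 × ℝ := fun x =>
    (constL (coeff 0 (x.2.2 : L2)) + x.1 • S x.2.2, x.2.1)
  have hE : Continuous E := by fun_prop
  have hE0 : E (0, ζ, g₀) = (H2.const a₀, ζ) := by
    simp only [E, hg₀0, zero_smul, add_zero, constL_apply]
  refine ⟨const_mem_constSolutions_iff.2 ha, mem_closure_iff_nhds.2 fun U hU => ?_⟩
  -- A nonzero k-th coefficient of g is an open condition; together with s ≠ 0 it makes the solution
  -- nonconstant.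
  have hV : ∀ᶠ x in 𝓝 ((0, ζ, g₀) : ℝ × ℝ × evenL2), E x ∈ U ∧ coeff k (x.2.2 : L2) ≠ 0 := by
    refine (hE.continuousAt.eventually (by rw [hE0]; exact hU)).and ?_
    have hc : Continuous fun x : ℝ × ℝ × evenL2 => coeff k (x.2.2 : L2) := by fun_prop
    refine hc.continuousAt.eventually_ne ?_
    change coeff k (g₀ : L2) ≠ 0
    have : (k : ℤ) ≠ 0 := by omega
    rw [hg₀, if_neg this, if_pos (abs_of_nonneg (by positivity))]
    exact mul_ne_zero (pow_ne_zero 2 hkC) hφ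
  have himg : Ψ '' {x | E x ∈ U ∧ coeff k (x.2.2 : L2) ≠ 0} ∈ 𝓝 ((0, 0) : ℝ × evenL2) := by
    rw [← hmap]
    exact image_mem_map hV
  -- The image of the neighbourhood under Ψ contains (s, 0) for all small s, so some s ≠ 0 can be
  -- chosen.
  have hcurve : Tendsto (fun s : ℝ => ((s, 0) : ℝ × evenL2)) (𝓝[≠] 0) (𝓝 (0, 0)) :=
    ((continuous_id.prodMk continuous_const).tendsto' (0 : ℝ) ((0, 0) : ℝ × evenL2) rfl).mono_left
      nhdsWithin_le_nhds
  obtain ⟨s, ⟨x, ⟨hxU, hxk⟩, hx⟩, hs⟩ :=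
    ((hcurve.eventually himg).and self_mem_nhdsWithin).exists
  have hx1 : x.1 = s := congrArg Prod.fst hx
  have hx2 : rescaled d κ f x.1 x.2.1 x.2.2 = 0 := congrArg Subtype.val (congrArg Prod.snd hx)
  have hs0 : x.1 ≠ 0 := hx1 ▸ hs
  refine ⟨E x, hxU, isSolution_of_rescaled hx2 hS, fun hconst => ?_⟩
  obtain ⟨c, hc, -⟩ := mem_constSolutions_iff.1 hconst
  have h1 : coeff k (H2.fn (E x).1) = 0 := by
    have : (k : ℤ) ≠ 0 := by omega
    rw [hc, fn_const, coeff_toL2_const, if_neg this]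
  change coeff k (H2.fn (constL (coeff 0 (x.2.2 : L2)) + x.1 • S x.2.2)) = 0 at h1
  have : (k : ℤ) ≠ 0 := by omega
  rw [← fnL_apply, map_add, map_smul, fnL_apply, fnL_apply, (hS _).1, constL_apply, fn_const,
    map_add, coeff_smul_real, coeff_toL2_const, if_neg this, zero_add, coeff_invLap] at h1
  refine mul_ne_zero (by exact_mod_cast hs0) (div_ne_zero hxk (pow_ne_zero 2 ?_)) h1
  exact_mod_cast this

end LugiatoLefever

end

open LugiatoLefever in
theorem theorem1 (d κ f : ℝ) (hd : d ≠ 0) (hκ : 0 < κ) (hf : f ≠ 0) :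
    -- (i) the constant solutions form a smooth (embedded) unbounded curve in `H²(𝕋) × ℝ`
    ((∃ γ : ℝ → H2 × ℝ, ContDiff ℝ ∞ γ ∧ (∀ t, deriv γ t ≠ 0) ∧ Topology.IsEmbedding γ ∧
        range γ = constSolutions d κ f) ∧
      ¬ Bornology.IsBounded (constSolutions d κ f) ∧
      ¬ Bornology.IsBounded (Prod.snd '' constSolutions d κ f)) ∧
    -- (ii) sufficient conditions for bifurcation
    (∀ (ζ : ℝ) (a₀ : ℂ), (H2.const a₀, ζ) ∈ constSolutions d κ f → 0 ≤ disc κ a₀ →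
      ∀ σ : ℝ, (σ = 1 ∨ σ = -1) →
        IsPosNat (kNumber d κ ζ a₀ σ) →
        (IsPosNat (kNumber d κ ζ a₀ (-σ)) → kNumber d κ ζ a₀ (-σ) = kNumber d κ ζ a₀ σ) →
        transversality κ ζ a₀ σ ≠ 0 →
        IsBifurcationPoint d κ f (H2.const a₀, ζ)) ∧
    -- (iii) the threshold beyond which there are no bifurcation points
    ((1 < f ^ 2 → IsGreatest (thresholdSet f) (kappaStar f) ∧
        ∀ k ∈ Ioo 0 (1 / √3), thresholdFun k = f ^ 2 ↔ k = kappaStar f) ∧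
      (f ^ 2 ≤ 1 → kappaStar f = 0) ∧
      (kappaStar f < κ → ∀ p ∈ constSolutions d κ f, ¬ IsBifurcationPoint d κ f p)) :=
  ⟨constSolutions_curve d f hκ,
    fun _ _ ha hD _ hσ hk hk' ht => isBifurcationPoint_of_transversality hd hκ hf
      (const_mem_constSolutions_iff.1 ha) hD hσ hk hk' ht,
    kappaStar_spec, fun h => if_neg (not_lt.2 h),
    fun h _ hp => not_isBifurcationPoint_of_kappaStar_lt hκ h hp⟩
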